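/- Let $K$ be a field and let $\Lambda$ be a symmetric special biserial $K$-algebra: $\Lambda\cong KQ/I$ with $Q$ a finite quiver and $I$ an admissible ideal, such that at most two arrows start and at most two arrows end at each vertex, and for every arrow $\alpha$ there is at most one arrow $\beta$ with $\alpha\beta\notin I$ and at most one arrow $\gamma$ with $\gamma\alpha\notin I$; and $\Lambda$ has a linear form $t$ with $t(xy)=t(yx)$ whose associated bilinear form is nondegenerate. Paths are written from left to right ($\alpha\beta$ is "first $\alpha$, then $\beta$"), and $P_j=\Lambda e_j$ is the indecomposable projective left module of the vertex $j$; an element $y\in e_j\Lambda e_i$ gives the map $P_j\to P_i$, $x\mapsto xy$. The extended quiver $Q_e$ is $Q$ with one formal loop added at each vertex at which exactly one arrow starts and exactly one arrow ends. In $Q_e$, an arrow $\beta$ follows an arrow $\alpha$ on an $A$-cycle if $\alpha,\beta$ are arrows of $Q$ with $\alpha\beta\ne 0$ in $\Lambda$, or if $\alpha=\beta$ is a formal loop; it follows $\alpha$ on a $G$-cycle if it starts where $\alpha$ ends and does not follow $\alpha$ on an $A$-cycle. The Brauer complex $C$ of $\Lambda$ has the $A$-cycles as its vertices, the vertices of $Q_e$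 as its edges, and the $G$-cycles as (the boundaries of) its faces. Let $i$ be an edge of $C$, i.e. a vertex of $Q$, and suppose that the connected component of $i$ contains another edge. Define a complex $T_i=\bigoplus_j T_{ij}$ of left $\Lambda$-modules as follows. For $j\neq i$, $T_{ij}$ is $P_j$ concentrated in degree $0$. The summand $T_{ii}$ is a complex with nonzero terms only in degrees $0$ and $1$, the term in degree $1$ being $P_i$: 1. If there is a loop $\alpha$ at $i$ in $Q_e$ that is an $A$-cycle ($i$ is a leaf of the $1$-skeleton of $C$), then $T_{ii}$ is $P_j\xrightarrow{\ \beta\ }P_i$, where $\beta\colon j\to i$, $j\ne i$, is the arrow preceding $\alpha$ on its $G$-cycle. 2. If there is a loop $\alpha$ at $i$ in $Q_e$ that is a $G$-cycle ($i$ is a loop bounding a face of $C$), then $T_{ii}$ is $P_j\oplus P_j\xrightarrow{(\beta,\ \beta\alpha)}P_i$, where $\beta\colon j\to i$, $j\neq i$, is the arrow preceding $\alpha$ on its $A$-cycle. 3. If there is no loop at $i$ in $Q_e$, then $T_{ii}$ is $P_{i_1}\oplus P_{i_2}\xrightarrow{(\beta_1,\ \beta_2)}P_i$, where $\beta_1\colon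 i_1\to i$ and $\beta_2\colon i_2\to i$ are the two distinct arrows ending at $i$ (possibly $i_1=i_2$). **Proposition.** The data required in at least one of the three cases exist, and for every choice of such data $T_i$ is a tilting complex over $\Lambda$. That is: $T_i$ is a bounded complex of finitely generated projective modules; the smallest (strictly full) triangulated subcategory of the homotopy category $K^b(\mathrm{proj}\,\Lambda)$ of bounded complexes of finitely generated projective modules that contains all direct summands of $T_i$ is $K^b(\mathrm{proj}\,\Lambda)$ itself; and $\operatorname{Hom}(T_i,T_i[r])=0$ in the homotopy category for every integer $r\neq 0$. -/

import Mathlib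

open CategoryTheory CategoryTheory.Limits

/-! ### Path algebras

A path `p = α₁ α₂ ⋯ αₙ` is written from left to right: the source of `αₖ₊₁` is the target of
`αₖ`.  The path algebra has the set of all paths (including the trivial ones) as a basis. -/

/-- The set of all paths of a quiver. -/
abbrev QuiverPath (V : Type*) [Quiver V] := Σ i : V, Σ j : V, Quiver.Path i j

/-- The path algebra `K V` of a quiver `V`: finite linear combinations of paths. -/
def PathAlgebra (K V : Type*) [Field K] [Quiver V] := QuiverPath V →₀ K

namespace PathAlgebra

variable (K : Type*) {V : Type*} [Field K] [Quiver V]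

noncomputable instance : AddCommGroup (PathAlgebra K V) :=
  inferInstanceAs (AddCommGroup (QuiverPath V →₀ K))

noncomputable instance : Module K (PathAlgebra K V) :=
  inferInstanceAs (Module K (QuiverPath V →₀ K))

/-- The basis vector given by a path from `i` to `j`. -/
noncomputable def ofPath {i j : V} (p : Quiver.Path i j) : PathAlgebra K V :=
  Finsupp.single (⟨i, j, p⟩ : QuiverPath V) (1 : K)

/-- The idempotent of a vertex: the trivial path. -/
noncomputable def idem (i : V) : PathAlgebra K V := ofPath K (Quiver.Path.nil : Quiver.Path i i)

/-- An arrow, as an element of the path algebra. -/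
noncomputable def arrow {i j : V} (a : i ⟶ j) : PathAlgebra K V := ofPath K a.toPath

open Classical in
/-- Concatenation of two basis paths, or `0` if they cannot be concatenated. -/
noncomputable def pathMul (p q : QuiverPath V) : PathAlgebra K V :=
  if h : p.2.1 = q.1 then ofPath K (p.2.2.comp (q.2.2.cast h.symm rfl)) else 0

/-- The multiplication of the path algebra: the bilinear extension of concatenation. -/
noncomputable def mulLin : PathAlgebra K V →ₗ[K] PathAlgebra K V →ₗ[K] PathAlgebra K V :=
  Finsupp.linearCombination K
    (fun p : QuiverPath V =>
      (Finsupp.linearCombination K (fun q : QuiverPath V => pathMul K p q) :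
        (QuiverPath V →₀ K) →ₗ[K] PathAlgebra K V))

noncomputable instance : Mul (PathAlgebra K V) := ⟨fun x y => mulLin K x y⟩

noncomputable instance [Fintype V] : One (PathAlgebra K V) := ⟨∑ i : V, idem K i⟩

variable {K}

lemma mul_def (x y : PathAlgebra K V) : x * y = mulLin K x y := rfl

lemma one_def [Fintype V] : (1 : PathAlgebra K V) = ∑ i : V, idem K i := rfl

lemma ofPath_mul (p q : QuiverPath V) :
    ofPath K p.2.2 * ofPath K q.2.2 = pathMul K p q := by
  rw [mul_def, mulLin, ofPath, ofPath]
  erw [Finsupp.linearCombination_single, one_smul, Finsupp.linearCombination_single, one_smul]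

lemma ofPath_mul_ofPath {i j k : V} (p : Quiver.Path i j) (q : Quiver.Path j k) :
    ofPath K p * ofPath K q = ofPath K (p.comp q) := by
  rw [ofPath_mul ⟨i, j, p⟩ ⟨j, k, q⟩, pathMul]
  simp

lemma ofPath_mul_ofPath_of_ne {i j k l : V} (h : j ≠ k) (p : Quiver.Path i j)
    (q : Quiver.Path k l) : ofPath K p * ofPath K q = 0 := by
  rw [ofPath_mul ⟨i, j, p⟩ ⟨k, l, q⟩, pathMul, dif_neg h]

@[elab_as_elim]
lemma induction {motive : PathAlgebra K V → Prop} (x : PathAlgebra K V)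
    (zero : motive 0) (add : ∀ x y, motive x → motive y → motive (x + y))
    (smul : ∀ (c : K) {i j : V} (p : Quiver.Path i j), motive (c • ofPath K p)) :
    motive x := by
  refine Finsupp.induction_linear x zero (fun f g hf hg => add f g hf hg) ?_
  rintro ⟨i, j, p⟩ c
  have h := smul c p
  have e : c • ofPath K p = (Finsupp.single (⟨i, j, p⟩ : QuiverPath V) c : QuiverPath V →₀ K) := by
    change c • (Finsupp.single (⟨i, j, p⟩ : QuiverPath V) (1 : K)) = _
    rw [Finsupp.smul_single, smul_eq_mul, mul_one]
  exact e ▸ h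

lemma smul_mul' (c : K) (x y : PathAlgebra K V) : (c • x) * y = c • (x * y) := by
  simp [mul_def]

lemma mul_smul' (c : K) (x y : PathAlgebra K V) : x * (c • y) = c • (x * y) := by
  simp [mul_def]

lemma add_mul' (x y z : PathAlgebra K V) : (x + y) * z = x * z + y * z := by
  simp [mul_def]

lemma mul_add' (x y z : PathAlgebra K V) : x * (y + z) = x * y + x * z := by
  simp [mul_def]

lemma zero_mul' (x : PathAlgebra K V) : 0 * x = 0 := by simp [mul_def]

lemma mul_zero' (x : PathAlgebra K V) : x * 0 = 0 := by simp [mul_def]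

lemma mul_assoc' (x y z : PathAlgebra K V) : x * y * z = x * (y * z) := by
  induction x using induction with
  | zero => simp only [zero_mul']
  | add a b ha hb => simp only [add_mul', ha, hb]
  | @smul c i j p =>
    induction y using induction with
    | zero => simp only [zero_mul', mul_zero']
    | add a b ha hb => simp only [add_mul', mul_add', ha, hb]
    | @smul d k l q =>
      induction z using induction with
      | zero => simp only [mul_zero']
      | add a b ha hb => simp only [mul_add', ha, hb]
      | @smul e m n r =>
        simp only [smul_mul', mul_smul']
        congr 3
        by_cases h : j = k
        · subst h
          by_cases h' : l = m
          · subst h'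
            simp only [ofPath_mul_ofPath, Quiver.Path.comp_assoc]
          · rw [ofPath_mul_ofPath, ofPath_mul_ofPath_of_ne h', ofPath_mul_ofPath_of_ne h',
              mul_zero']
        · rw [ofPath_mul_ofPath_of_ne h, zero_mul']
          by_cases h' : l = m
          · subst h'
            rw [ofPath_mul_ofPath, ofPath_mul_ofPath_of_ne h]
          · rw [ofPath_mul_ofPath_of_ne h', mul_zero']

lemma sum_mul' {ι : Type*} (s : Finset ι) (f : ι → PathAlgebra K V) (y : PathAlgebra K V) :
    (∑ i ∈ s, f i) * y = ∑ i ∈ s, f i * y := by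
  simp [mul_def]

lemma mul_sum' {ι : Type*} (s : Finset ι) (f : ι → PathAlgebra K V) (y : PathAlgebra K V) :
    y * (∑ i ∈ s, f i) = ∑ i ∈ s, y * f i := by
  simp [mul_def]

lemma one_mul' [Fintype V] (x : PathAlgebra K V) : 1 * x = x := by
  induction x using induction with
  | zero => simp only [mul_zero']
  | add a b ha hb => simp only [mul_add', ha, hb]
  | @smul c i j p =>
    rw [mul_smul', one_def, sum_mul', Finset.sum_eq_single i]
    · rw [idem, ofPath_mul_ofPath, Quiver.Path.nil_comp]
    · intro k _ hk
      exact ofPath_mul_ofPath_of_ne hk _ _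
    · simp

lemma mul_one' [Fintype V] (x : PathAlgebra K V) : x * 1 = x := by
  induction x using induction with
  | zero => simp only [zero_mul']
  | add a b ha hb => simp only [add_mul', ha, hb]
  | @smul c i j p =>
    rw [smul_mul', one_def, mul_sum', Finset.sum_eq_single j]
    · rw [idem, ofPath_mul_ofPath, Quiver.Path.comp_nil]
    · intro k _ hk
      exact ofPath_mul_ofPath_of_ne hk.symm _ _
    · simp

noncomputable instance [Fintype V] : Ring (PathAlgebra K V) :=
  { (inferInstance : AddCommGroup (PathAlgebra K V)) with
    mul := (· * ·)
    one := 1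
    left_distrib := mul_add'
    right_distrib := add_mul'
    zero_mul := zero_mul'
    mul_zero := mul_zero'
    mul_assoc := mul_assoc'
    one_mul := one_mul'
    mul_one := mul_one' }

noncomputable instance [Fintype V] : Algebra K (PathAlgebra K V) :=
  Algebra.ofModule smul_mul' mul_smul'

variable (K V)

/-- The `m`-th power of the ideal generated by the arrows: it is spanned by the paths of length
at least `m`. -/
noncomputable def arrowIdealPow (m : ℕ) : Submodule K (PathAlgebra K V) :=
  Submodule.span K {x | ∃ (i j : V) (p : Quiver.Path i j), m ≤ p.length ∧ x = ofPath K p}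

end PathAlgebra

/-! ### Symmetric special biserial algebras -/

/-- A `K`-algebra is symmetric if it has a linear form `t` with `t (x y) = t (y x)` whose
associated bilinear form is nondegenerate (for a finite-dimensional algebra this says that it is
isomorphic to its `K`-dual as a bimodule). -/
def HasSymmetrizingForm (K Λ : Type*) [Field K] [Ring Λ] [Algebra K Λ] : Prop :=
  ∃ t : Λ →ₗ[K] K, (∀ x y, t (x * y) = t (y * x)) ∧ ∀ x, (∀ y, t (x * y) = 0) → x = 0

/-- A presentation of the algebra `Λ` as a special biserial algebra `K V / I`: `V` is a finite
quiver, `I = ker φ` is an admissible ideal, at most two arrows start and at most two arrows end at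
each vertex, and for each arrow `a` there is at most one arrow `b` with `a b ∉ I` and at most one
arrow `b` with `b a ∉ I`. -/
structure SpecialBiserialPresentation (K Λ V : Type*) [Field K] [Ring Λ] [Algebra K Λ]
    [Quiver V] [Fintype V] [∀ i j : V, Finite (i ⟶ j)] where
  φ : PathAlgebra K V →ₐ[K] Λ
  surjective : Function.Surjective φ
  exists_arrowIdealPow_le : ∃ m : ℕ, ∀ x ∈ PathAlgebra.arrowIdealPow K V m, φ x = 0
  ker_le : ∀ x, φ x = 0 → x ∈ PathAlgebra.arrowIdealPow K V 2
  card_out_le_two : ∀ i : V, Nat.card (Σ j : V, i ⟶ j) ≤ 2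
  card_in_le_two : ∀ i : V, Nat.card (Σ j : V, j ⟶ i) ≤ 2
  next_unique : ∀ {i j : V} (a : i ⟶ j) (b b' : Σ k : V, j ⟶ k),
    φ (PathAlgebra.arrow K a * PathAlgebra.arrow K b.2) ≠ 0 →
    φ (PathAlgebra.arrow K a * PathAlgebra.arrow K b'.2) ≠ 0 → b = b'
  prev_unique : ∀ {i j : V} (a : i ⟶ j) (b b' : Σ k : V, k ⟶ i),
    φ (PathAlgebra.arrow K b.2 * PathAlgebra.arrow K a) ≠ 0 →
    φ (PathAlgebra.arrow K b'.2 * PathAlgebra.arrow K a) ≠ 0 → b = b'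

/-- The arrows of the extended quiver of a special biserial algebra: the arrows of the quiver,
together with one additional (formal) loop at every vertex at which exactly one arrow starts and
exactly one arrow ends. -/
inductive ExtendedArrow {V : Type*} [Quiver V] : V → V → Type _
  | real {i j : V} (a : i ⟶ j) : ExtendedArrow i j
  | formal (i : V) (hout : Nat.card (Σ j : V, i ⟶ j) = 1) (hin : Nat.card (Σ j : V, j ⟶ i) = 1) :
      ExtendedArrow i i

namespace SpecialBiserialPresentation

universe u

variable {K V : Type*} {Λ : Type u} [Field K] [Ring Λ] [Algebra K Λ]
  [Quiver V] [Fintype V] [∀ i j : V, Finite (i ⟶ j)] (P : SpecialBiserialPresentation K Λ V)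

/-- The image in `Λ` of the idempotent of a vertex. -/
noncomputable def e (i : V) : Λ := P.φ (PathAlgebra.idem K i)

/-- The image in `Λ` of an arrow. -/
noncomputable def arr {i j : V} (a : i ⟶ j) : Λ := P.φ (PathAlgebra.arrow K a)

/-- `P.ANext α β`: the arrow `β` of the extended quiver follows `α` on an `A`-cycle.  This holds
for arrows `α`, `β` of the quiver with `α β ≠ 0` in `Λ`, and every formal loop is an `A`-cycle
of its own. -/
def ANext : ∀ {i j k : V}, ExtendedArrow i j → ExtendedArrow j k → Prop
  | _, _, _, .real a, .real b => P.arr a * P.arr b ≠ 0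
  | _, _, _, .formal _ _ _, .formal _ _ _ => True
  | _, _, _, _, _ => False

/-- `P.GNext α β`: the arrow `β` of the extended quiver follows `α` on a `G`-cycle.  Of the two
arrows that start where `α` ends, this is the one which does not follow `α` on an `A`-cycle. -/
def GNext {i j k : V} (α : ExtendedArrow i j) (β : ExtendedArrow j k) : Prop :=
  ¬ P.ANext α β

/-- The indecomposable projective left module `P_i = Λ e_i`. -/
noncomputable def proj (i : V) : Submodule Λ Λ := Submodule.span Λ {P.e i}

lemma arr_mul_e {i j : V} (a : i ⟶ j) : P.arr a * P.e j = P.arr a := by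
  rw [arr, e, ← map_mul, PathAlgebra.arrow, PathAlgebra.idem, PathAlgebra.ofPath_mul_ofPath,
    Quiver.Path.comp_nil]

/-- The map `P_j ⟶ P_i`, `x ↦ x y`, given by right multiplication by an element `y` with
`y = y e_i`. -/
noncomputable def mulRight (j : V) {i : V} (y : Λ) (hy : y * P.e i = y) :
    P.proj j →ₗ[Λ] P.proj i :=
  ((LinearMap.toSpanSingleton Λ Λ y).domRestrict (P.proj j)).codRestrict (P.proj i) (fun x => by
    have h : (x : Λ) * y = ((x : Λ) * y) • P.e i := by rw [smul_eq_mul, mul_assoc, hy]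
    change (x : Λ) * y ∈ P.proj i
    rw [h]
    exact Submodule.smul_mem _ _ (Submodule.mem_span_singleton_self _))

/-- The data from which the nontrivial summand of the elementary complex of `i` is built.  There
are three cases: in the extended quiver there is a loop at `i` which is an `A`-cycle (the edge `i`
of the Brauer complex is a leaf), or there is a loop at `i` which is a `G`-cycle (the edge `i` is
a loop which bounds a face), or there is no loop at `i`. -/
inductive ElementaryData (i : V) : Type _
  /-- `α` is a loop at `i` which is an `A`-cycle, `β ≠ α` precedes `α` on its `G`-cycle. -/
  | leaf (α : ExtendedArrow i i) (hα : P.ANext α α) (j : V) (hj : j ≠ i) (β : j ⟶ i)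
      (hβ : P.GNext (.real β) α)
  /-- `α` is a loop at `i` which is a `G`-cycle, `β ≠ α` precedes `α` on its `A`-cycle. -/
  | faceLoop (α : i ⟶ i) (hα : P.GNext (.real α) (.real α)) (j : V) (hj : j ≠ i) (β : j ⟶ i)
      (hβ : P.ANext (.real β) (.real α))
  /-- There is no loop at `i`, and `β₁`, `β₂` are the two arrows ending at `i`; they lie on the
  two `A`-cycles through `i`. -/
  | general (h : IsEmpty (ExtendedArrow i i)) (i₁ i₂ : V) (β₁ : i₁ ⟶ i) (β₂ : i₂ ⟶ i)
      (hβ : (⟨i₁, β₁⟩ : Σ j : V, j ⟶ i) ≠ ⟨i₂, β₂⟩)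

/-- The two-term complex `M ⟶ N` with `M` in degree `0` and `N` in degree `1`. -/
noncomputable def twoTerm {M N : Type u} [AddCommGroup M] [Module Λ M] [AddCommGroup N]
    [Module Λ N] (f : M →ₗ[Λ] N) : CochainComplex (ModuleCat.{u} Λ) ℤ :=
  HomologicalComplex.double (ModuleCat.ofHom f) (i₀ := 0) (i₁ := 1) (by simp)

variable {P}

/-- The summand `T_{ii}` of the elementary complex: `P_j ⟶ P_i` with map `β` for a leaf,
`P_j ⊕ P_j ⟶ P_i` with map `(β, β α)` for a face-bounding loop, and
`P_{i₁} ⊕ P_{i₂} ⟶ P_i` with map `(β₁, β₂)` in general. -/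
noncomputable def ElementaryData.mainSummand {i : V} :
    P.ElementaryData i → CochainComplex (ModuleCat.{u} Λ) ℤ
  | .leaf _ _ j _ β _ => twoTerm (P.mulRight j (P.arr β) (P.arr_mul_e β))
  | .faceLoop α _ j _ β _ => twoTerm
      ((P.mulRight j (P.arr β) (P.arr_mul_e β)).coprod
        (P.mulRight j (P.arr β * P.arr α) (by rw [mul_assoc, P.arr_mul_e])))
  | .general _ i₁ i₂ β₁ β₂ _ => twoTerm
      ((P.mulRight i₁ (P.arr β₁) (P.arr_mul_e β₁)).coprod
        (P.mulRight i₂ (P.arr β₂) (P.arr_mul_e β₂)))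

instance : HasFiniteBiproducts (CochainComplex (ModuleCat.{u} Λ) ℤ) :=
  HasFiniteBiproducts.of_hasFiniteProducts

open Classical in
/-- The elementary complex `T_i = ⨁ⱼ T_{ij}`, where `T_{ij}` is the module `P_j` in degree `0`
for `j ≠ i`. -/
noncomputable def ElementaryData.complex {i : V} (D : P.ElementaryData i) :
    CochainComplex (ModuleCat.{u} Λ) ℤ :=
  ⨁ fun j : V => if j = i then D.mainSummand else
    (HomologicalComplex.single (ModuleCat.{u} Λ) (ComplexShape.up ℤ) 0).obj
      (ModuleCat.of Λ (P.proj j))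

end SpecialBiserialPresentation

/-! ### Tilting complexes -/

section Tilting

universe u

variable {Λ : Type u} [Ring Λ]

/-- The homotopy category of complexes of left `Λ`-modules. -/
abbrev ModHomotopyCategory (Λ : Type u) [Ring Λ] :=
  HomotopyCategory (ModuleCat.{u} Λ) (ComplexShape.up ℤ)

/-- The class of a complex in the homotopy category. -/
noncomputable abbrev toHomotopy (C : CochainComplex (ModuleCat.{u} Λ) ℤ) :
    ModHomotopyCategory Λ :=
  (HomotopyCategory.quotient (ModuleCat.{u} Λ) (ComplexShape.up ℤ)).obj C

/-- A bounded complex of finitely generated projective modules. -/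
def IsBoundedProjectiveComplex (C : CochainComplex (ModuleCat.{u} Λ) ℤ) : Prop :=
  (∃ a b : ℤ, ∀ n : ℤ, n < a ∨ b < n → IsZero (C.X n)) ∧
    ∀ n : ℤ, Module.Finite Λ (C.X n) ∧ Module.Projective Λ (C.X n)

/-- The homotopy category `Kᵇ(proj Λ)` of bounded complexes of finitely generated projective
modules, as a (strictly full) class of objects of the homotopy category of all complexes. -/
def KbProj (Λ : Type u) [Ring Λ] : ObjectProperty (ModHomotopyCategory Λ) := fun X =>
  ∃ C : CochainComplex (ModuleCat.{u} Λ) ℤ,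
    IsBoundedProjectiveComplex C ∧ Nonempty (X ≅ toHomotopy C)

/-- `T` is a tilting complex over `Λ`: a bounded complex of finitely generated projective modules
such that the smallest strictly full triangulated subcategory that contains all direct summands
of `T` in `Kᵇ(proj Λ)` is all of `Kᵇ(proj Λ)`, and such that there are no nonzero morphisms from
`T` to `T[r]` for `r ≠ 0`. -/
structure IsTiltingComplex (T : CochainComplex (ModuleCat.{u} Λ) ℤ) : Prop where
  bounded_projective : IsBoundedProjectiveComplex T
  generates : ∀ S : ObjectProperty (ModHomotopyCategory Λ),
    S.IsTriangulated → S.IsClosedUnderIsomorphisms →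
    (∀ X, KbProj Λ X → Nonempty (Retract X (toHomotopy T)) → S X) →
    ∀ X, KbProj Λ X → S X
  hom_shift_eq_zero : ∀ r : ℤ, r ≠ 0 →
    ∀ f : toHomotopy T ⟶ (shiftFunctor (ModHomotopyCategory Λ) r).obj (toHomotopy T), f = 0

end Tilting

/-! ### The filtration of the path algebra by path length. -/

namespace PathAlgebra

variable {K V : Type*} [Field K] [Quiver V]

/-! In all three cases `T_ii` has the form `f : N ⟶ P_i` with `N` a sum of modules `P_j`, `j ≠ i`,
and the image of `f` contains `e_k Λ e_i` for all `k ≠ i`. Indeed, a path from `k` to `i` is a path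
ending in an arrow that enters `i` from elsewhere, followed by loops at `i`; the image contains
those arrows and is stable under the loops (`isApproximation_of_arr_mem`).

This one fact gives two approximation properties (`IsApproximation`). Every map `P_j ⟶ P_i`, `j ≠
i`, lifts through `f`. A map `P_i ⟶ P_j` that kills the image of `f` is right multiplication by some
`y` in `e_i Λ e_j` with `e_j Λ e_i y = 0`; the symmetrizing form pairs these two corners
nondegenerately, so `y = 0`. The first property kills morphisms of degree `1` between the summands,
the second those of degree `-1`, and all other nonzero degrees vanish because the complexes live in
degrees `0` and `1`.

For generation, the brutal truncation of `T_ii` gives a triangle relating `P_i` (shifted), `T_ii`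
and `N`, so a triangulated subcategory containing the summands contains every `P_j`. It then
contains all finitely generated projectives by a Krull-Schmidt argument (`projective_induction`),
and all bounded complexes of them by induction on the length.

Existence of the data also rests on the form: connectedness and symmetry provide an arrow into `i`
from elsewhere, and the case follows from the loops at `i`; the delicate points are
`arr_mul_arr_ne_zero` and the existence of a second incoming arrow when there is no loop. -/

lemma arrowIdealPow_mul_le [Fintype V] (m n : ℕ) :
    arrowIdealPow K V m * arrowIdealPow K V n ≤ arrowIdealPow K V (m + n) := by
  rw [arrowIdealPow, arrowIdealPow, Submodule.span_mul_span, Submodule.span_le]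
  rintro _ ⟨_, ⟨i, j, p, hp, rfl⟩, _, ⟨k, l, q, hq, rfl⟩, rfl⟩
  by_cases h : j = k
  · subst h
    refine Submodule.subset_span ⟨i, l, p.comp q, ?_, ofPath_mul_ofPath p q⟩
    rw [Quiver.Path.length_comp]
    omega
  · change ofPath K p * ofPath K q ∈ arrowIdealPow K V (m + n)
    rw [ofPath_mul_ofPath_of_ne h]
    exact zero_mem _

lemma ofPath_mem_arrowIdealPow {i j : V} (p : Quiver.Path i j) {m : ℕ} (h : m ≤ p.length) :
    ofPath K p ∈ arrowIdealPow K V m :=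
  Submodule.subset_span ⟨i, j, p, h, rfl⟩

/-- The coefficient at `p` is a linear form that vanishes on all longer paths. -/
lemma ofPath_notMem_arrowIdealPow {i j : V} (p : Quiver.Path i j) {m : ℕ} (h : p.length < m) :
    ofPath K p ∉ arrowIdealPow K V m := by
  intro hp
  let f : PathAlgebra K V →ₗ[K] K :=
    (Finsupp.lapply (⟨i, j, p⟩ : QuiverPath V) : (QuiverPath V →₀ K) →ₗ[K] K)
  have hf : ∀ x ∈ arrowIdealPow K V m, f x = 0 := by
    intro x hx
    refine (Submodule.span_le (p := LinearMap.ker f)).2 ?_ hx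
    rintro _ ⟨k, l, q, hq, rfl⟩
    change (Finsupp.single (⟨k, l, q⟩ : QuiverPath V) (1 : K)) ⟨i, j, p⟩ = 0
    apply Finsupp.single_eq_of_ne
    intro he
    cases he
    omega
  have h1 : f (ofPath K p) = 1 := Finsupp.single_eq_same
  rw [hf _ hp] at h1
  exact zero_ne_one h1

end PathAlgebra

/-! ### Paths in `Λ`, the radical filtration `J`, and finiteness. -/

namespace SpecialBiserialPresentation

universe u

variable {K V : Type*} {Λ : Type u} [Field K] [Ring Λ] [Algebra K Λ]
  [Quiver V] [Fintype V] [∀ i j : V, Finite (i ⟶ j)] (P : SpecialBiserialPresentation K Λ V)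

/-- The image in `Λ` of a path. -/
noncomputable def path {i j : V} (p : Quiver.Path i j) : Λ := P.φ (PathAlgebra.ofPath K p)

lemma path_nil (i : V) : P.path (Quiver.Path.nil : Quiver.Path i i) = P.e i := rfl

lemma path_mul_path {i j k : V} (p : Quiver.Path i j) (q : Quiver.Path j k) :
    P.path p * P.path q = P.path (p.comp q) := by
  rw [path, path, ← map_mul, PathAlgebra.ofPath_mul_ofPath, path]

lemma path_mul_path_of_ne {i j k l : V} (h : j ≠ k) (p : Quiver.Path i j)
    (q : Quiver.Path k l) : P.path p * P.path q = 0 := by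
  rw [path, path, ← map_mul, PathAlgebra.ofPath_mul_ofPath_of_ne h, map_zero]

lemma path_cons {i j k : V} (p : Quiver.Path i j) (a : j ⟶ k) :
    P.path (p.cons a) = P.path p * P.arr a :=
  (P.path_mul_path p a.toPath).symm

lemma e_mul_path {i j : V} (p : Quiver.Path i j) : P.e i * P.path p = P.path p := by
  rw [← path_nil, path_mul_path, Quiver.Path.nil_comp]

lemma path_mul_e {i j : V} (p : Quiver.Path i j) : P.path p * P.e j = P.path p := by
  rw [← path_nil, path_mul_path, Quiver.Path.comp_nil]

lemma e_mul_arr {i j : V} (a : i ⟶ j) : P.e i * P.arr a = P.arr a := P.e_mul_path a.toPath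

lemma e_mul_e (i : V) : P.e i * P.e i = P.e i := P.e_mul_path Quiver.Path.nil

lemma sum_e : ∑ i, P.e i = 1 := by
  rw [← map_one P.φ, PathAlgebra.one_def, map_sum]
  rfl

lemma sum_e_mul (x : Λ) : ∑ i, P.e i * x = x := by
  rw [← Finset.sum_mul, sum_e, one_mul]

lemma sum_mul_e (x : Λ) : ∑ i, x * P.e i = x := by
  rw [← Finset.mul_sum, sum_e, mul_one]

lemma span_path_eq_top :
    Submodule.span K {x : Λ | ∃ (i j : V) (p : Quiver.Path i j), x = P.path p} = ⊤ := by
  rw [eq_top_iff]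
  rintro x -
  obtain ⟨y, rfl⟩ := P.surjective x
  induction y using PathAlgebra.induction with
  | zero => rw [map_zero]; exact zero_mem _
  | add a b ha hb => rw [map_add]; exact add_mem ha hb
  | @smul c i j p =>
    rw [map_smul]
    exact Submodule.smul_mem _ _ (Submodule.subset_span ⟨i, j, p, rfl⟩)

/-- The idempotents kill all paths with other endpoints, so statements about the corner `e_k Λ e_l`
reduce to single paths. -/
lemma e_mul_mul_e_mem {k l : V} {L : Submodule K Λ} (h : ∀ p : Quiver.Path k l, P.path p ∈ L)
    (x : Λ) : P.e k * x * P.e l ∈ L := by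
  have hx : x ∈ Submodule.span K {x : Λ | ∃ (i j : V) (p : Quiver.Path i j), x = P.path p} := by
    rw [span_path_eq_top]; trivial
  induction hx using Submodule.span_induction with
  | zero => rw [mul_zero, zero_mul]; exact zero_mem _
  | add a b _ _ ha hb => rw [mul_add, add_mul]; exact add_mem ha hb
  | smul c a _ ha =>
    rw [mul_smul_comm, smul_mul_assoc]
    exact Submodule.smul_mem _ _ ha
  | mem x hx =>
    obtain ⟨i, j, p, rfl⟩ := hx
    by_cases hi : k = i
    · subst hi
      by_cases hj : j = l
      · subst hj
        rw [e_mul_path, path_mul_e]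
        exact h p
      · rw [e_mul_path, ← path_nil, path_mul_path_of_ne _ hj]
        exact zero_mem _
    · rw [← path_nil, path_mul_path_of_ne _ hi, zero_mul]
      exact zero_mem _

/-- The image in `Λ` of the span of the paths of length at least `n`. -/
noncomputable def J (n : ℕ) : Submodule K Λ :=
  (PathAlgebra.arrowIdealPow K V n).map P.φ.toLinearMap

lemma path_mem_J {i j : V} (p : Quiver.Path i j) {n : ℕ} (h : n ≤ p.length) : P.path p ∈ P.J n :=
  Submodule.mem_map_of_mem (PathAlgebra.ofPath_mem_arrowIdealPow p h)

lemma J_zero : P.J 0 = ⊤ := by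
  rw [← P.span_path_eq_top, J, PathAlgebra.arrowIdealPow, Submodule.map_span]
  congr 1
  ext x
  constructor
  · rintro ⟨_, ⟨i, j, p, -, rfl⟩, rfl⟩
    exact ⟨i, j, p, rfl⟩
  · rintro ⟨i, j, p, rfl⟩
    exact ⟨_, ⟨i, j, p, Nat.zero_le _, rfl⟩, rfl⟩

lemma mul_mem_J {m n : ℕ} {x y : Λ} (hx : x ∈ P.J m) (hy : y ∈ P.J n) : x * y ∈ P.J (m + n) := by
  obtain ⟨x, hx, rfl⟩ := hx
  obtain ⟨y, hy, rfl⟩ := hy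
  refine ⟨x * y, PathAlgebra.arrowIdealPow_mul_le m n (Submodule.mul_mem_mul hx hy), ?_⟩
  exact map_mul P.φ x y

lemma mul_mem_J_right {n : ℕ} {x : Λ} (y : Λ) (hx : x ∈ P.J n) : x * y ∈ P.J n := by
  have h := P.mul_mem_J (n := 0) (y := y) hx (by rw [J_zero]; trivial)
  rwa [add_zero] at h

lemma exists_J_eq_bot : ∃ m, P.J m = ⊥ := by
  obtain ⟨m, hm⟩ := P.exists_arrowIdealPow_le
  refine ⟨m, ?_⟩
  rw [eq_bot_iff]
  rintro _ ⟨x, hx, rfl⟩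
  exact hm x hx

lemma pow_mem_J {x : Λ} (hx : x ∈ P.J 1) (n : ℕ) : x ^ n ∈ P.J n := by
  induction n with
  | zero => rw [J_zero]; trivial
  | succ n ih => rw [pow_succ]; exact P.mul_mem_J ih hx

lemma isNilpotent_of_mem_J {x : Λ} (hx : x ∈ P.J 1) : IsNilpotent x := by
  obtain ⟨m, hm⟩ := P.exists_J_eq_bot
  have h := P.pow_mem_J hx m
  rw [hm] at h
  exact ⟨m, h⟩

lemma arr_mem_J {i j : V} (a : i ⟶ j) : P.arr a ∈ P.J 1 := P.path_mem_J a.toPath le_rfl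

/-- An element of the squared arrow ideal with the same image would differ from the arrow by an
element of `I`, which lies in that square as well; then so would the arrow. -/
lemma arr_notMem_J_two {i j : V} (a : i ⟶ j) : P.arr a ∉ P.J 2 := by
  rintro ⟨x, hx, h⟩
  have h1 := P.ker_le (PathAlgebra.arrow K a - x) (by
    rw [map_sub, sub_eq_zero]
    exact h.symm)
  refine PathAlgebra.ofPath_notMem_arrowIdealPow (K := K) a.toPath (m := 2) (by simp) ?_
  have h2 := add_mem h1 hx
  rwa [sub_add_cancel] at h2

lemma e_ne_zero (i : V) : P.e i ≠ 0 := fun h =>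
  PathAlgebra.ofPath_notMem_arrowIdealPow (K := K) (Quiver.Path.nil : Quiver.Path i i) (m := 2)
    (by simp) (P.ker_le _ h)

lemma arr_ne_zero {i j : V} (a : i ⟶ j) : P.arr a ≠ 0 := fun h =>
  P.arr_notMem_J_two a (h ▸ zero_mem _)

lemma e_mul_mul_e_mem_J {k l : V} (h : k ≠ l) (x : Λ) : P.e k * x * P.e l ∈ P.J 1 := by
  refine P.e_mul_mul_e_mem (fun p => P.path_mem_J p ?_) x
  cases p with
  | nil => exact absurd rfl h
  | cons p a => simp

/-- The trivial path is the only path of length `0` at `j`; so `e_j Λ e_j` is local with residue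
field `K`. -/
lemma exists_e_mul_mul_e_eq (j : V) (x : Λ) :
    ∃ (c : K) (r : Λ), r ∈ P.J 1 ∧ P.e j * x * P.e j = c • P.e j + r := by
  have h : P.e j * x * P.e j ∈ Submodule.span K {P.e j} ⊔ P.J 1 := by
    refine P.e_mul_mul_e_mem (fun p => ?_) x
    cases p with
    | nil => exact Submodule.mem_sup_left (Submodule.mem_span_singleton_self _)
    | cons p a => exact Submodule.mem_sup_right (P.path_mem_J _ (by simp))
  obtain ⟨y, hy, r, hr, h⟩ := Submodule.mem_sup.1 h
  obtain ⟨c, rfl⟩ := Submodule.mem_span_singleton.1 hy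
  exact ⟨c, r, hr, h.symm⟩

/-- A left ideal contains `e_k Λ e_i`, `k ≠ i`, if it contains the arrows that end at `i` and
start elsewhere, and is stable under right multiplication by the loops at `i`. -/
lemma e_mul_mul_e_mem_of_arr_mem {i : V} (L : Submodule Λ Λ)
    (harr : ∀ (k : V) (b : k ⟶ i), k ≠ i → P.arr b ∈ L)
    (hloop : ∀ (a : i ⟶ i) (x : Λ), x ∈ L → x * P.arr a ∈ L) {k : V} (hk : k ≠ i) (x : Λ) :
    P.e k * x * P.e i ∈ L := by
  -- The last arrow is a loop at `i`, and the shorter path also ends at `i`, or it enters from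
  -- elsewhere and lies in the left ideal. The endpoint is a variable so that induction on the path
  -- applies.
  have key : ∀ (l : V) (p : Quiver.Path k l), l = i → P.path p ∈ L := by
    intro l p
    induction p with
    | nil => exact fun h => absurd h hk
    | @cons m l p a ih =>
      rintro rfl
      rw [path_cons]
      by_cases hm : m = l
      · subst hm
        exact hloop a _ (ih rfl)
      · exact L.smul_mem _ (harr m a hm)
  exact P.e_mul_mul_e_mem (L := L.restrictScalars K) (fun p => key i p rfl) x

lemma finite (P : SpecialBiserialPresentation K Λ V) : Module.Finite K Λ := by
  obtain ⟨m, hm⟩ := P.exists_J_eq_bot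
  have hfin : ∀ n, {x : Λ | ∃ (i j : V) (p : Quiver.Path i j), p.length = n ∧
      x = P.path p}.Finite := by
    intro n
    induction n with
    | zero =>
      refine (Set.finite_range fun i => P.e i).subset ?_
      rintro _ ⟨i, j, p, hp, rfl⟩
      cases p with
      | nil => exact ⟨i, rfl⟩
      | cons p a => simp at hp
    | succ n ih =>
      refine (ih.image2 (fun x y => x * y)
        (Set.finite_range fun a : Σ i j : V, i ⟶ j => P.arr a.2.2)).subset ?_
      rintro _ ⟨i, j, p, hp, rfl⟩
      cases p with
      | nil => simp at hp
      | @cons k _ p a =>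
        refine ⟨P.path p, ⟨i, k, p, by simpa using hp, rfl⟩, P.arr a, ⟨⟨k, j, a⟩, rfl⟩, ?_⟩
        exact (P.path_cons p a).symm
  have hS : (⋃ n ∈ Set.Iio m, {x : Λ | ∃ (i j : V) (p : Quiver.Path i j), p.length = n ∧
      x = P.path p}).Finite := (Set.finite_Iio m).biUnion fun n _ => hfin n
  refine ⟨hS.toFinset, ?_⟩
  rw [eq_top_iff, ← P.span_path_eq_top, Submodule.span_le]
  rintro _ ⟨i, j, p, rfl⟩
  by_cases hp : p.length < m
  · refine Submodule.subset_span ?_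
    simp only [Set.Finite.coe_toFinset, Set.mem_iUnion]
    exact ⟨p.length, hp, i, j, p, rfl, rfl⟩
  · have h := P.path_mem_J p (not_lt.1 hp)
    rw [hm] at h
    rw [(Submodule.mem_bot K).1 h]
    exact zero_mem _

lemma isArtinianRing (P : SpecialBiserialPresentation K Λ V) : IsArtinianRing Λ :=
  have := P.finite
  isArtinian_of_tower K inferInstance

end SpecialBiserialPresentation

/-! ### Consequences of the symmetrizing form, and existence of the data. -/

lemma Nat.eq_or_eq_of_card_le_two {α : Type*} [Finite α] (h : Nat.card α ≤ 2) {a b : α}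
    (hab : a ≠ b) (x : α) : x = a ∨ x = b := by
  classical
  by_contra! hx
  have := Fintype.ofFinite α
  rw [Nat.card_eq_fintype_card] at h
  have h3 : ({x, a, b} : Finset α).card = 3 := by
    rw [Finset.card_eq_three]
    exact ⟨x, a, b, hx.1, hx.2, hab, rfl⟩
  have := Finset.card_le_univ ({x, a, b} : Finset α)
  omega

/-- A symmetric nondegenerate linear form on an algebra. -/
structure IsSymmetrizing {K Λ : Type*} [Field K] [Ring Λ] [Algebra K Λ] (t : Λ →ₗ[K] K) :
    Prop where
  apply_mul_comm : ∀ x y, t (x * y) = t (y * x)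
  eq_zero : ∀ x, (∀ y, t (x * y) = 0) → x = 0

namespace SpecialBiserialPresentation

universe u

variable {K V : Type*} {Λ : Type u} [Field K] [Ring Λ] [Algebra K Λ]
  [Quiver V] [Fintype V] [∀ i j : V, Finite (i ⟶ j)] (P : SpecialBiserialPresentation K Λ V)

variable {P} in
lemma arr_eq_of_mk_eq {i j k : V} {a : j ⟶ i} {b : k ⟶ i}
    (h : (⟨j, a⟩ : Σ j : V, j ⟶ i) = ⟨k, b⟩) : P.arr a = P.arr b := by
  cases h
  rfl

lemma in_eq_or_eq (P : SpecialBiserialPresentation K Λ V) {i : V} {a b : Σ j : V, j ⟶ i} (hab : a ≠ b) (x : Σ j : V, j ⟶ i) :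
    x = a ∨ x = b :=
  Nat.eq_or_eq_of_card_le_two (P.card_in_le_two i) hab x

lemma arr_mul_arr_eq_zero_or {i j k k' : V} (a : i ⟶ j) {b : j ⟶ k} {b' : j ⟶ k'}
    (h : (⟨k, b⟩ : Σ k : V, j ⟶ k) ≠ ⟨k', b'⟩) :
    P.arr a * P.arr b = 0 ∨ P.arr a * P.arr b' = 0 := by
  by_contra! hc
  refine h (P.next_unique a ⟨k, b⟩ ⟨k', b'⟩ ?_ ?_)
  · rw [map_mul]; exact hc.1
  · rw [map_mul]; exact hc.2

lemma arr_mul_arr_eq_zero_or' {i j k k' : V} (a : i ⟶ j) {b : k ⟶ i} {b' : k' ⟶ i}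
    (h : (⟨k, b⟩ : Σ k : V, k ⟶ i) ≠ ⟨k', b'⟩) :
    P.arr b * P.arr a = 0 ∨ P.arr b' * P.arr a = 0 := by
  by_contra! hc
  refine h (P.prev_unique a ⟨k, b⟩ ⟨k', b'⟩ ?_ ?_)
  · rw [map_mul]; exact hc.1
  · rw [map_mul]; exact hc.2

section Symmetric

variable {t : Λ →ₗ[K] K}

/-- A nonzero element of `e_i Λ e_k` pairs nontrivially with `e_k Λ e_i`. -/
lemma exists_apply_mul_ne_zero (ht : IsSymmetrizing t) {i k : V} {x : Λ} (hx : x ≠ 0) (hi : P.e i * x = x)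
    (hk : x * P.e k = x) : ∃ y, t (x * (P.e k * y * P.e i)) ≠ 0 := by
  by_contra! h
  refine hx (ht.eq_zero x fun y => ?_)
  rw [← h y, ← mul_assoc, ← mul_assoc, hk, ht.apply_mul_comm _ (P.e i), ← mul_assoc, hi]

/-- Without such an arrow `e_k Λ e_i` would vanish, and `g` would have nothing to pair with. -/
lemma exists_arr_ne_of_arr (P : SpecialBiserialPresentation K Λ V)
    (ht : IsSymmetrizing t) {i k : V} (g : i ⟶ k) (hk : k ≠ i) :
    ∃ (l : V) (_ : l ⟶ i), l ≠ i := by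
  by_contra! h
  obtain ⟨y, hy⟩ := P.exists_apply_mul_ne_zero ht (P.arr_ne_zero g) (P.e_mul_arr g)
    (P.arr_mul_e g)
  refine hy ?_
  have h1 := P.e_mul_mul_e_mem_of_arr_mem (i := i) ⊥ (fun l b hl => absurd (h l b) hl)
    (fun a x hx => by rw [(Submodule.mem_bot Λ).1 hx, zero_mul]; exact zero_mem _) hk y
  rw [(Submodule.mem_bot Λ).1 h1, mul_zero, map_zero]

/-- On an undirected walk from `j` to `i`, the last step between distinct vertices is an arrow into
`i` or the reverse of an arrow out of `i`; symmetry settles the second case. -/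
lemma exists_arr_to (P : SpecialBiserialPresentation K Λ V)
    (ht : IsSymmetrizing t) {i j : V} (hj : j ≠ i)
    (h : Quiver.WeaklyConnectedComponent.mk j = Quiver.WeaklyConnectedComponent.mk i) :
    ∃ (l : V) (_ : l ⟶ i), l ≠ i := by
  obtain ⟨p⟩ : Nonempty (@Quiver.Path (Quiver.Symmetrify V) _ j i) :=
    (Quiver.WeaklyConnectedComponent.eq j i).1 h
  have key : ∀ (k : Quiver.Symmetrify V) (p : @Quiver.Path (Quiver.Symmetrify V) _ j k),
      k = i → ∃ (l : V) (_ : l ⟶ i), l ≠ i := by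
    intro k p
    induction p with
    | nil => exact fun h => absurd h hj
    | @cons m k p a ih =>
      rintro rfl
      by_cases hm : m = k
      · exact ih hm
      · rcases a with a | a
        · exact ⟨m, a, hm⟩
        · exact P.exists_arr_ne_of_arr ht a hm
  exact key i p rfl

/-- Otherwise only the trivial path starts at `i`, so `e_i Λ e_j = 0` and `b` pairs to zero with
everything. -/
lemma exists_arr_from (P : SpecialBiserialPresentation K Λ V)
    (ht : IsSymmetrizing t) {i j : V} (b : j ⟶ i) (hj : j ≠ i) : ∃ (k : V), Nonempty (i ⟶ k) := by
  by_contra! h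
  obtain ⟨y, hy⟩ := P.exists_apply_mul_ne_zero ht (P.arr_ne_zero b) (P.e_mul_arr b)
    (P.arr_mul_e b)
  refine hy ?_
  have h1 := P.e_mul_mul_e_mem (k := i) (l := j) (L := ⊥) (fun p => by
    suffices ∀ (l : V) (p : Quiver.Path i l), l = i by exact absurd (this j p) hj
    intro l p
    induction p with
    | nil => rfl
    | cons p a ih => subst ih; exact ((h _).false a).elim) y
  rw [(Submodule.mem_bot K).1 h1, mul_zero, map_zero]

/-- If a loop `a` at `i` satisfies `a² = 0`, then `b a ≠ 0` for an arrow `b` that ends at `i` and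
starts elsewhere: otherwise `a` would lie in the socle of `Λ e_i`, which is contained in `J²`. -/
lemma arr_mul_arr_ne_zero (P : SpecialBiserialPresentation K Λ V)
    (ht : IsSymmetrizing t) {i j : V} (a : i ⟶ i) (haa : P.arr a * P.arr a = 0) (b : j ⟶ i)
    (hj : j ≠ i) : P.arr b * P.arr a ≠ 0 := by
  intro hba
  have hab : (⟨j, b⟩ : Σ j : V, j ⟶ i) ≠ ⟨i, a⟩ := fun h => hj (congrArg Sigma.fst h)
  -- The arrows into `i` are exactly `b` and `a`, and both annihilate `a` from the left.
  have hJa : ∀ r ∈ P.J 1, r * P.arr a = 0 := by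
    rintro _ ⟨r, hr, rfl⟩
    refine (Submodule.span_le (p := LinearMap.ker
      ((LinearMap.mulRight K (P.arr a)).comp P.φ.toLinearMap))).2 ?_ hr
    rintro _ ⟨k, l, p, hp, rfl⟩
    change P.path p * P.arr a = 0
    cases p with
    | nil => simp at hp
    | @cons m _ p c =>
      rw [path_cons]
      by_cases hl : l = i
      · subst hl
        rw [mul_assoc]
        rcases P.in_eq_or_eq hab ⟨m, c⟩ with h | h
        · rw [arr_eq_of_mk_eq (P := P) h, hba, mul_zero]
        · rw [arr_eq_of_mk_eq (P := P) h, haa, mul_zero]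
      · rw [mul_assoc]
        have : P.arr c * P.arr a = 0 := P.path_mul_path_of_ne hl c.toPath a.toPath
        rw [this, mul_zero]
  -- Multiply `b` from the left by radical elements while the product stays nonzero; nilpotency
  -- stops this at a nonzero socle element of `Λ b`.
  have hz : ∃ (n : ℕ) (w : Λ), w ∈ P.J n ∧ w * P.arr b ≠ 0 ∧
      ∀ r ∈ P.J 1, r * (w * P.arr b) = 0 := by
    by_contra! hn
    have h : ∀ n, ∃ w ∈ P.J n, w * P.arr b ≠ 0 := by
      intro n
      induction n with
      | zero => exact ⟨1, by rw [J_zero]; trivial, by rw [one_mul]; exact P.arr_ne_zero b⟩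
      | succ n ih =>
        obtain ⟨w, hw, hw0⟩ := ih
        obtain ⟨r, hr, hrw⟩ := hn n w hw hw0
        refine ⟨r * w, ?_, by rwa [mul_assoc]⟩
        rw [add_comm]
        exact P.mul_mem_J hr hw
    obtain ⟨m, hm⟩ := P.exists_J_eq_bot
    obtain ⟨w, hw, hw0⟩ := h m
    rw [hm] at hw
    exact hw0 (by rw [(Submodule.mem_bot K).1 hw, zero_mul])
  obtain ⟨-, w, -, hw0, hw⟩ := hz
  -- For `z` in the socle of `Λ e_i`, every `t (z y)` is a scalar multiple of `t z`, because `e_i Λ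
  -- e_i` is `K e_i` plus radical elements. So `t` is injective on this socle.
  have happ : ∀ {z : Λ}, z * P.e i = z → (∀ r ∈ P.J 1, r * z = 0) → t z = 0 → z = 0 := by
    intro z hz hJz htz
    refine ht.eq_zero z fun y => ?_
    obtain ⟨c, r, hr, hc⟩ := P.exists_e_mul_mul_e_eq i y
    have h1 : P.e i * y * z = c • (P.e i * z) := by
      rw [← P.sum_e_mul z, Finset.mul_sum, Finset.sum_eq_single i, ← mul_assoc, hc, add_mul,
        hJz r hr, add_zero, smul_mul_assoc, sum_e_mul]
      · intro k _ hk
        rw [← mul_assoc, hJz _ (P.e_mul_mul_e_mem_J hk.symm y)]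
      · simp
    rw [← hz, mul_assoc, ht.apply_mul_comm, h1, map_smul, ht.apply_mul_comm, hz, htz,
      smul_zero]
  have hzi : w * P.arr b * P.e i = w * P.arr b := by rw [mul_assoc, arr_mul_e]
  have htz : t (P.e i * (w * P.arr b)) ≠ 0 := by
    rw [ht.apply_mul_comm, hzi]
    exact fun h => hw0 (happ hzi hw h)
  set z := P.e i * (w * P.arr b) with hz
  have hz2 : z ∈ P.J 2 := by
    rw [hz, ← P.e_mul_arr b, ← mul_assoc, ← mul_assoc]
    exact P.mul_mem_J (m := 1) (n := 1) (P.e_mul_mul_e_mem_J hj.symm w) (P.arr_mem_J b)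
  -- This combination is in the socle and is killed by `t`. As `t z ≠ 0`, the arrow `a` becomes a
  -- multiple of `z`, which lies in `J 2`.
  have h0 : t z • P.arr a - t (P.arr a) • z = 0 := by
    refine happ ?_ (fun r hr => ?_) ?_
    · rw [sub_mul, smul_mul_assoc, smul_mul_assoc, arr_mul_e, hz, mul_assoc, hzi]
    · rw [mul_sub, mul_smul_comm, mul_smul_comm, hJa r hr, hz, ← mul_assoc r,
        hw _ (P.mul_mem_J_right _ hr), smul_zero, smul_zero, sub_zero]
    · rw [map_sub, map_smul, map_smul, smul_eq_mul, smul_eq_mul, mul_comm, sub_self]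
  refine P.arr_notMem_J_two a ?_
  rw [← inv_smul_smul₀ htz (P.arr a), sub_eq_zero.1 h0]
  exact Submodule.smul_mem _ _ (Submodule.smul_mem _ _ hz2)

lemma nonempty_elementaryData (hΛ : HasSymmetrizingForm K Λ) {i j : V} (hj : j ≠ i)
    (hij : Quiver.WeaklyConnectedComponent.mk j = Quiver.WeaklyConnectedComponent.mk i) :
    Nonempty (P.ElementaryData i) := by
  obtain ⟨t, ht⟩ := hΛ
  replace ht : IsSymmetrizing t := ⟨ht.1, ht.2⟩
  obtain ⟨l, b, hl⟩ := P.exists_arr_to ht hj hij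
  by_cases hreal : Nonempty (i ⟶ i)
  · obtain ⟨a⟩ := hreal
    have hba : (⟨l, b⟩ : Σ j : V, j ⟶ i) ≠ ⟨i, a⟩ := fun h => hl (congrArg Sigma.fst h)
    by_cases haa : P.arr a * P.arr a = 0
    · exact ⟨.faceLoop a (by simpa [GNext, ANext] using haa) l hl b
        (P.arr_mul_arr_ne_zero ht a haa b hl)⟩
    -- Since `a a ≠ 0`, uniqueness of the predecessor of `a` forces `b a = 0`.
    · refine ⟨.leaf (.real a) haa l hl b ?_⟩
      simpa [GNext, ANext] using (P.arr_mul_arr_eq_zero_or' a hba).resolve_right haa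
  · by_cases hformal : Nat.card (Σ j : V, i ⟶ j) = 1 ∧ Nat.card (Σ j : V, j ⟶ i) = 1
    · exact ⟨.leaf (.formal i hformal.1 hformal.2) trivial l hl b id⟩
    have hempty : IsEmpty (ExtendedArrow i i) := by
      refine ⟨fun a => ?_⟩
      cases a with
      | real a => exact hreal ⟨a⟩
      | formal h1 h2 => exact hformal ⟨h1, h2⟩
    by_cases hin : ∃ x : Σ j : V, j ⟶ i, x ≠ ⟨l, b⟩
    · obtain ⟨⟨l', b'⟩, h⟩ := hin
      exact ⟨.general hempty l' l b' b h⟩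
    -- Now `b` is the only arrow into `i`. Some arrow leaves `i`, and as there is no formal loop, at
    -- least two do; one of them, `c`, has `b c = 0`.
    exfalso
    push Not at hin
    obtain ⟨k, ⟨g⟩⟩ := P.exists_arr_from ht b hl
    have hout : ∃ x : Σ j : V, i ⟶ j, x ≠ ⟨k, g⟩ := by
      by_contra! hout
      exact hformal ⟨Nat.card_eq_one_iff_exists.2 ⟨_, hout⟩, Nat.card_eq_one_iff_exists.2 ⟨_, hin⟩⟩
    obtain ⟨⟨k', g'⟩, hg⟩ := hout
    -- Every path from `m` to `i` ends in `b`, so `b c = 0` would give `e_m Λ e_i c = 0`, against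
    -- nondegeneracy.
    have key : ∀ (m : V) (c : i ⟶ m), P.arr b * P.arr c ≠ 0 := by
      intro m c hbc
      have hm : m ≠ i := by
        rintro rfl
        exact hreal ⟨c⟩
      obtain ⟨y, hy⟩ := P.exists_apply_mul_ne_zero ht (P.arr_ne_zero c) (P.e_mul_arr c)
        (P.arr_mul_e c)
      have h := P.e_mul_mul_e_mem_of_arr_mem (i := i)
        (LinearMap.ker (LinearMap.toSpanSingleton Λ Λ (P.arr c))) (fun n d _ => by
          rw [arr_eq_of_mk_eq (P := P) (hin ⟨n, d⟩)]
          exact hbc) (fun a => (hreal ⟨a⟩).elim) hm y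
      rw [ht.apply_mul_comm] at hy
      refine hy ?_
      have h' : P.e m * y * P.e i * P.arr c = 0 := h
      rw [h', map_zero]
    rcases P.arr_mul_arr_eq_zero_or b hg with h | h
    · exact key _ _ h
    · exact key _ _ h

end Symmetric

/-! ### Maps between the modules `P_j`, and approximations of `P_i`. -/

lemma mem_proj {i : V} {x : Λ} : x ∈ P.proj i ↔ x * P.e i = x := by
  rw [proj, Submodule.mem_span_singleton]
  constructor
  · rintro ⟨a, rfl⟩
    rw [smul_eq_mul, mul_assoc, e_mul_e]
  · exact fun h => ⟨x, h⟩

lemma e_mem_proj (i : V) : P.e i ∈ P.proj i := P.mem_proj.2 (P.e_mul_e i)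

lemma map_proj_apply {N : Type*} [AddCommGroup N] [Module Λ N] {j : V} (g : P.proj j →ₗ[Λ] N)
    (x : P.proj j) : g x = (x : Λ) • g ⟨P.e j, P.e_mem_proj j⟩ := by
  rw [← map_smul]
  congr 1
  exact Subtype.ext (P.mem_proj.1 x.2).symm

lemma proj_hom_ext {N : Type*} [AddCommGroup N] [Module Λ N] {j : V} {g h : P.proj j →ₗ[Λ] N}
    (H : g ⟨P.e j, P.e_mem_proj j⟩ = h ⟨P.e j, P.e_mem_proj j⟩) : g = h := by
  ext x
  rw [map_proj_apply, map_proj_apply P h, H]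

/-- A map out of `P_j` is determined by the image of `e_j`, and this image lies in the corner `e_j Λ
e_i`. -/
lemma e_mul_map_e {i j : V} (g : P.proj j →ₗ[Λ] P.proj i) :
    P.e j * (g ⟨P.e j, P.e_mem_proj j⟩ : P.proj i) * P.e i = (g ⟨P.e j, P.e_mem_proj j⟩ : Λ) := by
  rw [mul_assoc, P.mem_proj.1 (Subtype.mem _)]
  conv_rhs => rw [map_proj_apply]
  rfl

/-- The finite direct sums of indecomposable projective modules `P_j` with `j ≠ i`. -/
inductive IsAddAway (i : V) : ModuleCat.{u} Λ → Prop
  | proj (j : V) (hj : j ≠ i) : IsAddAway i (ModuleCat.of Λ (P.proj j))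
  | prod {M N : ModuleCat.{u} Λ} (hM : IsAddAway i M) (hN : IsAddAway i N) :
      IsAddAway i (ModuleCat.of Λ (M × N))

/-- A left and right approximation of `P_i` by the modules `P_j`, `j ≠ i`: all maps `P_j ⟶ P_i`
factor through it, and no nonzero map `P_i ⟶ P_j` vanishes on it. -/
structure IsApproximation {i : V} {N : Type u} [AddCommGroup N] [Module Λ N]
    (f : N →ₗ[Λ] P.proj i) : Prop where
  exists_factor : ∀ {j : V}, j ≠ i → ∀ g : P.proj j →ₗ[Λ] P.proj i,
    ∃ h : P.proj j →ₗ[Λ] N, f ∘ₗ h = g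
  eq_zero : ∀ {j : V}, j ≠ i → ∀ g : P.proj i →ₗ[Λ] P.proj j, g ∘ₗ f = 0 → g = 0

variable {P}

/-- To factor `g`, lift `g e_j` to some `n` in `N` and send `x` to `x n`. For the second property,
`g ∘ f = 0` means that `g e_i` is annihilated from the left by `e_j Λ e_i`, so the form pairs it to
zero with its dual corner. -/
lemma isApproximation_of_mem_range (hΛ : HasSymmetrizingForm K Λ) {i : V} {N : Type u}
    [AddCommGroup N] [Module Λ N] (f : N →ₗ[Λ] P.proj i)
    (hf : ∀ (k : V), k ≠ i → ∀ x : Λ, ∃ n, (f n : Λ) = P.e k * x * P.e i) :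
    P.IsApproximation f where
  exists_factor {j} hj g := by
    obtain ⟨n, hn⟩ := hf j hj (g ⟨P.e j, P.e_mem_proj j⟩ : P.proj i)
    rw [e_mul_map_e] at hn
    refine ⟨(LinearMap.toSpanSingleton Λ N n).domRestrict (P.proj j), ?_⟩
    ext x
    rw [map_proj_apply P g]
    change (f ((x : Λ) • n) : Λ) = _
    rw [map_smul, Subtype.ext hn]
  eq_zero {j} hj g hg := by
    obtain ⟨t, ht⟩ := hΛ
    apply proj_hom_ext
    rw [LinearMap.zero_apply]
    by_contra h0
    have h1 := P.e_mul_map_e g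
    obtain ⟨y, hy⟩ := P.exists_apply_mul_ne_zero (i := i) (k := j)
      (x := (g ⟨P.e i, P.e_mem_proj i⟩ : Λ)) ⟨ht.1, ht.2⟩
      (fun h => h0 (Subtype.ext h)) (by
        rw [← h1, ← mul_assoc, ← mul_assoc, e_mul_e]) (by rw [← h1, mul_assoc, e_mul_e])
    obtain ⟨n, hn⟩ := hf j hj y
    refine hy ?_
    rw [ht.1, ← hn]
    have h2 := congrArg Subtype.val (LinearMap.congr_fun hg n)
    rw [LinearMap.comp_apply, map_proj_apply] at h2
    change ((f n : Λ) * (g ⟨P.e i, P.e_mem_proj i⟩ : Λ)) = 0 at h2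
    rw [h2, map_zero]

lemma isApproximation_of_arr_mem (hΛ : HasSymmetrizingForm K Λ) {i : V} {N : Type u}
    [AddCommGroup N] [Module Λ N] (f : N →ₗ[Λ] P.proj i)
    (harr : ∀ (k : V) (b : k ⟶ i), k ≠ i → ∃ n, (f n : Λ) = P.arr b)
    (hloop : ∀ (a : i ⟶ i) (n : N), ∃ n', (f n' : Λ) = f n * P.arr a) :
    P.IsApproximation f := by
  refine isApproximation_of_mem_range hΛ f fun k hk x => ?_
  refine P.e_mul_mul_e_mem_of_arr_mem ((P.proj i).subtype ∘ₗ f).range harr ?_ hk x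
  rintro a _ ⟨n, rfl⟩
  exact hloop a n

lemma IsApproximation.exists_comp_eq {i : V} {N : Type u} [AddCommGroup N] [Module Λ N]
    {f : N →ₗ[Λ] P.proj i} (hf : P.IsApproximation f) {M : ModuleCat.{u} Λ}
    (hM : P.IsAddAway i M) (g : M →ₗ[Λ] P.proj i) : ∃ h : M →ₗ[Λ] N, f ∘ₗ h = g := by
  induction hM with
  | proj j hj => exact hf.exists_factor hj g
  | prod _ _ ih₁ ih₂ =>
    obtain ⟨h₁, e₁⟩ := ih₁ (g ∘ₗ LinearMap.inl _ _ _)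
    obtain ⟨h₂, e₂⟩ := ih₂ (g ∘ₗ LinearMap.inr _ _ _)
    refine ⟨h₁.coprod h₂, ?_⟩
    rw [LinearMap.comp_coprod, e₁, e₂, ← LinearMap.comp_coprod, LinearMap.coprod_inl_inr,
      LinearMap.comp_id]

lemma IsApproximation.eq_zero_of_comp {i : V} {N : Type u} [AddCommGroup N] [Module Λ N]
    {f : N →ₗ[Λ] P.proj i} (hf : P.IsApproximation f) {M : ModuleCat.{u} Λ}
    (hM : P.IsAddAway i M) (g : P.proj i →ₗ[Λ] M) (hg : g ∘ₗ f = 0) : g = 0 := by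
  induction hM with
  | proj j hj => exact hf.eq_zero hj g hg
  | prod _ _ ih₁ ih₂ =>
    have h₁ := ih₁ (LinearMap.fst _ _ _ ∘ₗ g) (by rw [LinearMap.comp_assoc, hg, LinearMap.comp_zero])
    have h₂ := ih₂ (LinearMap.snd _ _ _ ∘ₗ g) (by rw [LinearMap.comp_assoc, hg, LinearMap.comp_zero])
    exact LinearMap.ext fun x =>
      Prod.ext (LinearMap.congr_fun h₁ x) (LinearMap.congr_fun h₂ x)

lemma mulRight_apply {i j : V} {y : Λ} (hy : y * P.e i = y) (x : P.proj j) :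
    (P.mulRight j y hy x : Λ) = x * y := rfl

/-- Only the stability of the image under loops differs between the cases: for a leaf `β` kills any
real loop, for a face loop `α α = 0` makes the span of `β` and `β α` stable, and in general there
are no loops. -/
lemma ElementaryData.exists_isApproximation (hΛ : HasSymmetrizingForm K Λ) {i : V}
    (D : P.ElementaryData i) : ∃ (N : ModuleCat.{u} Λ) (f : N →ₗ[Λ] P.proj i),
      D.mainSummand = twoTerm f ∧ P.IsAddAway i N ∧ P.IsApproximation f := by
  cases D with
  | leaf α hα j hj β hβ =>
    have hin : ∀ (k : V) (b : k ⟶ i), (⟨k, b⟩ : Σ k : V, k ⟶ i) = ⟨j, β⟩ ∨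
        ∃ h : k = i, P.arr β * P.arr (h ▸ b : i ⟶ i) = 0 := by
      intro k b
      cases α with
      | real a =>
        have h : (⟨j, β⟩ : Σ k : V, k ⟶ i) ≠ ⟨i, a⟩ := fun h => hj (congrArg Sigma.fst h)
        refine (P.in_eq_or_eq h ⟨k, b⟩).imp_right fun h => ?_
        cases h
        exact ⟨rfl, by simpa [GNext, ANext] using hβ⟩
      | formal hout hin =>
        left
        obtain ⟨x, hx⟩ := Nat.card_eq_one_iff_exists.1 hin
        rw [hx ⟨k, b⟩, hx ⟨j, β⟩]
    refine ⟨_, _, rfl, .proj j hj, isApproximation_of_arr_mem hΛ _ ?_ ?_⟩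
    · intro k b hk
      refine ⟨⟨P.e j, P.e_mem_proj j⟩, ?_⟩
      rw [mulRight_apply, e_mul_arr]
      rcases hin k b with h | ⟨h, -⟩
      · exact (arr_eq_of_mk_eq h).symm
      · exact absurd h hk
    · intro a n
      rcases hin i a with h | ⟨_, h⟩
      · exact absurd (congrArg Sigma.fst h).symm hj
      · refine ⟨0, ?_⟩
        rw [map_zero, mulRight_apply, mul_assoc, h, mul_zero, ZeroMemClass.coe_zero]
  | faceLoop α hα j hj β hβ =>
    have h : (⟨j, β⟩ : Σ k : V, k ⟶ i) ≠ ⟨i, α⟩ := fun h => hj (congrArg Sigma.fst h)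
    have hαα : P.arr α * P.arr α = 0 := by simpa [GNext, ANext] using hα
    refine ⟨_, _, rfl, .prod (.proj j hj) (.proj j hj), isApproximation_of_arr_mem hΛ _ ?_ ?_⟩
    · intro k b hk
      refine ⟨(⟨P.e j, P.e_mem_proj j⟩, 0), ?_⟩
      rw [LinearMap.coprod_apply, map_zero, add_zero, mulRight_apply, e_mul_arr]
      rcases P.in_eq_or_eq h ⟨k, b⟩ with h | h
      · exact (arr_eq_of_mk_eq h).symm
      · exact absurd (congrArg Sigma.fst h) hk
    · rintro a ⟨n₁, n₂⟩
      -- Right multiplication by `α` sends `n₁ β + n₂ β α` to `n₁ β α`.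
      refine ⟨(0, n₁), ?_⟩
      have ha : P.arr a = P.arr α := by
        rcases P.in_eq_or_eq h ⟨i, a⟩ with h | h
        · exact absurd (congrArg Sigma.fst h).symm hj
        · exact arr_eq_of_mk_eq h
      rw [ha, LinearMap.coprod_apply, LinearMap.coprod_apply, map_zero, zero_add,
        Submodule.coe_add, mulRight_apply, mulRight_apply, mulRight_apply, add_mul,
        mul_assoc (n₂ : Λ), mul_assoc (P.arr β), hαα, mul_zero, mul_zero, add_zero, mul_assoc]
  | general h i₁ i₂ β₁ β₂ hβ =>
    have hne : ∀ {k : V}, (k ⟶ i) → k ≠ i := by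
      rintro k b rfl
      exact h.false (.real b)
    refine ⟨_, _, rfl, .prod (.proj i₁ (hne β₁)) (.proj i₂ (hne β₂)),
      isApproximation_of_arr_mem hΛ _ ?_ fun a => absurd rfl (hne a)⟩
    intro k b _
    rcases P.in_eq_or_eq hβ ⟨k, b⟩ with h | h
    · refine ⟨(⟨P.e i₁, P.e_mem_proj i₁⟩, 0), ?_⟩
      rw [LinearMap.coprod_apply, map_zero, add_zero, mulRight_apply, e_mul_arr,
        arr_eq_of_mk_eq h]
    · refine ⟨(0, ⟨P.e i₂, P.e_mem_proj i₂⟩), ?_⟩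
      rw [LinearMap.coprod_apply, map_zero, zero_add, mulRight_apply, e_mul_arr,
        arr_eq_of_mk_eq h]

end SpecialBiserialPresentation

/-! ### Decomposition of finitely generated projective modules. -/

namespace SpecialBiserialPresentation

universe u

variable {K V : Type*} {Λ : Type u} [Field K] [Ring Λ] [Algebra K Λ]
  [Quiver V] [Fintype V] [∀ i j : V, Finite (i ⟶ j)] (P : SpecialBiserialPresentation K Λ V)

instance (j : V) : Module.Finite Λ (P.proj j) :=
  Module.Finite.of_fg (Submodule.fg_span_singleton _)

instance (j : V) : Module.Projective Λ (P.proj j) :=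
  Module.Projective.of_split (P.proj j).subtype
    ((LinearMap.toSpanSingleton Λ Λ (P.e j)).codRestrict (P.proj j)
      fun x => P.mem_proj.2 (by
        rw [LinearMap.toSpanSingleton_apply, smul_eq_mul, mul_assoc, e_mul_e]))
    (LinearMap.ext fun x => Subtype.ext (P.mem_proj.1 x.2))

/-- If all linear forms on a projective module take values in the radical, the module is zero. -/
lemma exists_apply_notMem_J {N : Type*} [AddCommGroup N] [Module Λ N] [Module.Projective Λ N]
    [Nontrivial N] : ∃ (h : N →ₗ[Λ] Λ) (n : N), h n ∉ P.J 1 := by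
  by_contra! hc
  obtain ⟨s, hs⟩ := Module.projective_def'.1 (inferInstance : Module.Projective Λ N)
  -- A Nakayama argument: the section `s` writes `h n` as a combination of values of `h` whose
  -- coefficients are themselves values of linear forms, hence in `J 1`. Each pass gains one power
  -- of the radical.
  have key : ∀ m, ∀ (h : N →ₗ[Λ] Λ) (n : N), h n ∈ P.J m := by
    intro m
    induction m with
    | zero => intro h n; rw [J_zero]; trivial
    | succ m ih =>
      intro h n
      have hn : h n = (s n).sum fun k c => c * h k := by
        conv_lhs => rw [← LinearMap.id_apply (R := Λ) n, ← hs, LinearMap.comp_apply,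
          Finsupp.linearCombination_apply, map_finsuppSum]
        simp
      rw [hn, add_comm]
      refine Submodule.sum_mem _ fun k _ => P.mul_mem_J ?_ (ih h k)
      exact hc (Finsupp.lapply k ∘ₗ s) n
  obtain ⟨m, hm⟩ := P.exists_J_eq_bot
  obtain ⟨n, hn⟩ := exists_ne (0 : N)
  refine hn ?_
  have h0 : s n = 0 := by
    ext k
    have := key m (Finsupp.lapply k ∘ₗ s) n
    rw [hm] at this
    exact this
  rw [← LinearMap.id_apply (R := Λ) n, ← hs, LinearMap.comp_apply, h0, map_zero]

/-- A nonzero projective module has an indecomposable projective module `P_j` as a direct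
summand. -/
lemma exists_comp_eq_id (N : Type*) [AddCommGroup N] [Module Λ N] [Module.Projective Λ N]
    [Nontrivial N] : ∃ (j : V) (f : N →ₗ[Λ] P.proj j) (g : P.proj j →ₗ[Λ] N),
      f ∘ₗ g = LinearMap.id := by
  obtain ⟨h, n, hn⟩ := P.exists_apply_notMem_J (N := N)
  obtain ⟨j, hj⟩ : ∃ j, P.e j * h n * P.e j ∉ P.J 1 := by
    by_contra! hc
    refine hn ?_
    rw [← P.sum_e_mul (h n)]
    refine Submodule.sum_mem _ fun j _ => ?_
    rw [← P.sum_mul_e (P.e j * h n)]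
    refine Submodule.sum_mem _ fun l _ => ?_
    by_cases hl : j = l
    · subst hl; exact hc j
    · exact P.e_mul_mul_e_mem_J hl _
  obtain ⟨c, r, hr, hc⟩ := P.exists_e_mul_mul_e_eq j (h n)
  have hc0 : c ≠ 0 := by
    rintro rfl
    rw [hc, zero_smul, zero_add] at hj
    exact hj hr
  have hru : r * P.e j = r := by
    rw [eq_sub_of_add_eq' hc.symm, sub_mul, mul_assoc, e_mul_e, smul_mul_assoc, e_mul_e]
  have hur : P.e j * r = r := by
    rw [eq_sub_of_add_eq' hc.symm, mul_sub, ← mul_assoc, ← mul_assoc, e_mul_e, mul_smul_comm,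
      e_mul_e]
  -- A nonzero scalar plus a commuting nilpotent; this unit `u` satisfies `u e_j = e_j h(n) e_j`.
  obtain ⟨u, hu⟩ : IsUnit (algebraMap K Λ c + r) :=
    (P.isNilpotent_of_mem_J hr).isUnit_add_left_of_commute
      ((IsUnit.mk0 c hc0).map (algebraMap K Λ)) (Algebra.commutes c r).symm
  have hue : (u : Λ) * P.e j = P.e j * h n * P.e j := by
    rw [hu, hc, add_mul, hru, Algebra.smul_def]
  have heu : P.e j * (u : Λ) = (u : Λ) * P.e j := by
    rw [hue, hu, hc, mul_add, hur, Algebra.smul_def, Algebra.commutes]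
  have hinv : P.e j * ((u⁻¹ : Λˣ) : Λ) = ((u⁻¹ : Λˣ) : Λ) * P.e j := by
    rw [Units.mul_inv_eq_iff_eq_mul, mul_assoc, heu, Units.inv_mul_cancel_left]
  -- The retraction is `h` followed by right multiplication by `e_j`; the section sends `e_j` to
  -- `e_j u⁻¹ n`, the factor `u⁻¹` making the composite the identity.
  refine ⟨j, (LinearMap.toSpanSingleton Λ Λ (P.e j) ∘ₗ h).codRestrict (P.proj j) fun x =>
    P.mem_proj.2 ?_, (LinearMap.toSpanSingleton Λ N (((u⁻¹ : Λˣ) : Λ) • n)).domRestrict (P.proj j),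
    ?_⟩
  · rw [LinearMap.comp_apply, LinearMap.toSpanSingleton_apply, smul_eq_mul, mul_assoc, e_mul_e]
  · ext x
    change h ((x : Λ) • ((u⁻¹ : Λˣ) : Λ) • n) * P.e j = x
    rw [map_smul, map_smul, smul_eq_mul, smul_eq_mul]
    conv_lhs => rw [← P.mem_proj.1 x.2, mul_assoc (x : Λ), ← mul_assoc (P.e j), hinv,
      mul_assoc, mul_assoc, mul_assoc ((u⁻¹ : Λˣ) : Λ), ← mul_assoc (P.e j), ← hue, Units.inv_mul_cancel_left]
    exact P.mem_proj.1 x.2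

/-- Krull-Schmidt: a property of modules that holds for the `P_j`, is stable under isomorphisms
and direct sums and holds for the zero module holds for all finitely generated projective
modules. -/
lemma projective_induction {motive : ModuleCat.{u} Λ → Prop}
    (iso : ∀ {M N : ModuleCat.{u} Λ}, (M ≃ₗ[Λ] N) → motive M → motive N)
    (zero : ∀ M : ModuleCat.{u} Λ, Subsingleton M → motive M)
    (proj : ∀ j, motive (ModuleCat.of Λ (P.proj j)))
    (prod : ∀ M N : ModuleCat.{u} Λ, Module.Projective Λ N → motive M → motive N →
      motive (ModuleCat.of Λ (M × N)))
    (M : ModuleCat.{u} Λ) [Module.Finite Λ M] [Module.Projective Λ M] : motive M := by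
  have := P.isArtinianRing
  -- Well-founded induction on submodules of the Artinian module `M`: split off a `P_j`, and view
  -- the kernel of the retraction as a strictly smaller submodule of `M`.
  have key : ∀ N : Submodule Λ M, Module.Projective Λ N → motive (ModuleCat.of Λ N) := by
    intro N
    induction N using WellFoundedLT.induction with
    | ind N ih =>
      intro hN
      by_cases hs : Subsingleton N
      · exact zero _ hs
      rw [not_subsingleton_iff_nontrivial] at hs
      obtain ⟨j, f, g, hfg⟩ := P.exists_comp_eq_id N
      have hfg' : ∀ x, f (g x) = x := fun x => LinearMap.congr_fun hfg x
      let e : N ≃ₗ[Λ] (P.proj j × LinearMap.ker f) := LinearEquiv.ofLinearMap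
        (f.prod ((LinearMap.id - g ∘ₗ f).codRestrict _ fun x => by simp [hfg']))
        (g.coprod (LinearMap.ker f).subtype)
        (by ext x <;> simp [hfg'])
        (by ext x; simp)
      let N' := (LinearMap.ker f).map N.subtype
      have e' : LinearMap.ker f ≃ₗ[Λ] N' :=
        (LinearMap.ker f).equivMapOfInjective _ N.injective_subtype
      have hker : Module.Projective Λ (LinearMap.ker f) :=
        Module.Projective.of_split (e.symm.toLinearMap ∘ₗ LinearMap.inr _ _ _)
          (LinearMap.snd _ _ _ ∘ₗ e.toLinearMap) (by ext; simp)
      have hlt : N' < N := by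
        refine lt_of_le_of_ne (Submodule.map_subtype_le N _) fun h => ?_
        have hker0 : LinearMap.ker f = ⊤ :=
          Submodule.map_injective_of_injective N.injective_subtype
            (h.trans (Submodule.map_subtype_top N).symm)
        have h0 := hfg' ⟨P.e j, P.e_mem_proj j⟩
        rw [LinearMap.ker_eq_top.1 hker0, LinearMap.zero_apply] at h0
        exact P.e_ne_zero j (congrArg Subtype.val h0).symm
      have h1 := ih N' hlt (Module.Projective.of_equiv e')
      exact iso (M := ModuleCat.of Λ (P.proj j × LinearMap.ker f)) (N := ModuleCat.of Λ N) e.symm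
        (prod (ModuleCat.of Λ (P.proj j)) (ModuleCat.of Λ (LinearMap.ker f)) hker (proj j)
          (iso (M := ModuleCat.of Λ N') e'.symm h1))
  exact iso (M := ModuleCat.of Λ (⊤ : Submodule Λ M)) Submodule.topEquiv
    (key ⊤ (Module.Projective.of_equiv Submodule.topEquiv.symm))

end SpecialBiserialPresentation

/-! ### Triangles from short exact sequences, and brutal truncation. -/

section

universe u

variable {Λ : Type u} [Ring Λ]

open HomologicalComplex CochainComplex

/-- A short exact sequence of complexes whose third term consists of projective modules gives a
distinguished triangle in the homotopy category. -/
lemma exists_distinguished_of_shortExact {S : ShortComplex (CochainComplex (ModuleCat.{u} Λ) ℤ)}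
    (hS : S.ShortExact) (hproj : ∀ n, Module.Projective Λ (S.X₃.X n)) :
    ∃ T ∈ Pretriangulated.distinguishedTriangles (C := ModHomotopyCategory Λ),
      T.obj₁ = toHomotopy S.X₁ ∧ T.obj₂ = toHomotopy S.X₂ ∧ T.obj₃ = toHomotopy S.X₃ := by
  have σ : ∀ n, (S.map (eval (ModuleCat.{u} Λ) (ComplexShape.up ℤ) n)).Splitting := fun n =>
    have : Projective ((S.map (eval (ModuleCat.{u} Λ) (ComplexShape.up ℤ) n)).X₃) :=
      (IsProjective.iff_projective (R := Λ) (S.X₃.X n)).1 (hproj n)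
    ShortComplex.ShortExact.splittingOfProjective (hS.map_of_exact _)
  exact ⟨trianglehOfDegreewiseSplit S σ,
    (HomotopyCategory.distinguished_iff_iso_trianglehOfDegreewiseSplit _).2 ⟨S, σ, ⟨Iso.refl _⟩⟩,
    rfl, rfl, rfl⟩

namespace CochainComplex

variable (C : CochainComplex (ModuleCat.{u} Λ) ℤ) (b : ℤ)

/-- The part of a complex in degrees at least `b`, as a graded submodule. -/
noncomputable def stupidPart (n : ℤ) : Submodule Λ (C.X n) := if b ≤ n then ⊤ else ⊥

variable {b} in
lemma stupidPart_eq_top {n : ℤ} (h : b ≤ n) : stupidPart C b n = ⊤ := if_pos h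

variable {b} in
lemma stupidPart_eq_bot {n : ℤ} (h : n < b) : stupidPart C b n = ⊥ := if_neg (not_le.2 h)

lemma stupidPart_le_comap (m n : ℤ) :
    stupidPart C b m ≤ (stupidPart C b n).comap (C.d m n).hom := by
  rcases le_or_gt b n with h | h
  · rw [stupidPart_eq_top C h, Submodule.comap_top]
    exact le_top
  rcases le_or_gt b m with h' | h'
  -- Here `n < b ≤ m`, so the differential vanishes because it raises degrees.
  · rw [C.shape m n (by simp; omega)]
    exact fun x _ => Submodule.zero_mem _
  · rw [stupidPart_eq_bot C h']
    exact bot_le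

/-- The subcomplex of a complex in degrees at least `b`. -/
noncomputable def stupidSub : CochainComplex (ModuleCat.{u} Λ) ℤ where
  X n := ModuleCat.of Λ (stupidPart C b n)
  d m n := ModuleCat.ofHom ((C.d m n).hom.restrict (stupidPart_le_comap C b m n))
  shape m n h := by
    ext x
    have := congrArg (fun f => f.hom x.1) (C.shape m n h)
    exact this
  d_comp_d' l m n _ _ := by
    ext x
    have := congrArg (fun f => f.hom x.1) (C.d_comp_d l m n)
    exact this

/-- The quotient of a complex by its part in degrees at least `b`. -/
noncomputable def stupidQuot : CochainComplex (ModuleCat.{u} Λ) ℤ where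
  X n := ModuleCat.of Λ (C.X n ⧸ stupidPart C b n)
  d m n := ModuleCat.ofHom (Submodule.mapQ _ _ (C.d m n).hom (stupidPart_le_comap C b m n))
  shape m n h := by
    ext x
    change Submodule.Quotient.mk ((C.d m n).hom x) = 0
    rw [C.shape m n h]
    rfl
  d_comp_d' l m n _ _ := by
    ext x
    change Submodule.Quotient.mk ((C.d l m ≫ C.d m n).hom x) = 0
    rw [C.d_comp_d]
    rfl

/-- The short exact sequence given by the part of a complex in degrees at least `b`. -/
noncomputable def stupidShortComplex : ShortComplex (CochainComplex (ModuleCat.{u} Λ) ℤ) where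
  X₁ := stupidSub C b
  X₂ := C
  X₃ := stupidQuot C b
  f := { f := fun n => ModuleCat.ofHom (stupidPart C b n).subtype }
  g := { f := fun n => ModuleCat.ofHom (stupidPart C b n).mkQ }
  zero := by
    ext n x
    exact (Submodule.Quotient.mk_eq_zero _).2 x.2

lemma stupidShortComplex_shortExact : (stupidShortComplex C b).ShortExact := by
  refine shortExact_of_degreewise_shortExact _ fun n => ?_
  refine ModuleCat.shortComplex_shortExact _ ?_ ?_ ?_
  · exact LinearMap.exact_subtype_mkQ _
  · exact Subtype.val_injective
  · exact Submodule.mkQ_surjective _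

variable {C b}

lemma isZero_stupidSub_X_of_lt {n : ℤ} (h : n < b) : IsZero ((stupidSub C b).X n) := by
  refine ModuleCat.isZero_iff_subsingleton.2 (?_ : Subsingleton (stupidPart C b n))
  rw [stupidPart_eq_bot C h]
  infer_instance

lemma isZero_stupidQuot_X_of_le {n : ℤ} (h : b ≤ n) : IsZero ((stupidQuot C b).X n) := by
  refine ModuleCat.isZero_iff_subsingleton.2 (?_ : Subsingleton (C.X n ⧸ stupidPart C b n))
  rw [stupidPart_eq_top C h]
  infer_instance

lemma nonempty_stupidSub_X_iso {n : ℤ} (h : b ≤ n) : Nonempty ((stupidSub C b).X n ≅ C.X n) :=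
  ⟨(LinearEquiv.ofTop _ (stupidPart_eq_top C h)).toModuleIso⟩

lemma nonempty_stupidQuot_X_iso {n : ℤ} (h : n < b) : Nonempty ((stupidQuot C b).X n ≅ C.X n) :=
  ⟨(Submodule.quotEquivOfEqBot _ (stupidPart_eq_bot C h)).toModuleIso⟩

end CochainComplex

lemma sum_biproduct_π_comp_ι {J : Type*} [Fintype J]
    (X : J → CochainComplex (ModuleCat.{u} Λ) ℤ) :
    ∑ j, biproduct.π X j ≫ biproduct.ι X j = 𝟙 (⨁ X) := by
  refine biproduct.hom_ext _ _ fun k => ?_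
  rw [Preadditive.sum_comp, Finset.sum_eq_single k]
  · simp
  · intro j _ hj
    rw [Category.assoc, biproduct.ι_π_ne _ hj, comp_zero]
  · simp

/-- A module is finitely generated and projective. -/
def IsFiniteProjective (M : ModuleCat.{u} Λ) : Prop := Module.Finite Λ M ∧ Module.Projective Λ M

lemma IsFiniteProjective.of_iso {M N : ModuleCat.{u} Λ} (h : IsFiniteProjective M) (e : M ≅ N) :
    IsFiniteProjective N :=
  have := h.1
  have := h.2
  ⟨Module.Finite.equiv e.toLinearEquiv, Module.Projective.of_equiv e.toLinearEquiv⟩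

lemma IsFiniteProjective.of_isZero {M : ModuleCat.{u} Λ} (h : IsZero M) :
    IsFiniteProjective M :=
  have := ModuleCat.subsingleton_of_isZero h
  ⟨inferInstance, Module.Projective.of_lifting_property'' fun _ _ =>
    ⟨0, LinearMap.ext fun _ => Subsingleton.elim _ _⟩⟩

lemma isFiniteProjective_stupidSub_X {C : CochainComplex (ModuleCat.{u} Λ) ℤ} {b n : ℤ}
    (h : IsFiniteProjective (C.X n)) : IsFiniteProjective ((stupidSub C b).X n) := by
  rcases le_or_gt b n with hn | hn
  · exact h.of_iso (nonempty_stupidSub_X_iso hn).some.symm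
  · exact .of_isZero (isZero_stupidSub_X_of_lt hn)

lemma isFiniteProjective_stupidQuot_X {C : CochainComplex (ModuleCat.{u} Λ) ℤ} {b n : ℤ}
    (h : IsFiniteProjective (C.X n)) : IsFiniteProjective ((stupidQuot C b).X n) := by
  rcases le_or_gt b n with hn | hn
  · exact .of_isZero (isZero_stupidQuot_X_of_le hn)
  · exact h.of_iso (nonempty_stupidQuot_X_iso hn).some.symm

lemma isFiniteProjective_single_X {M : ModuleCat.{u} Λ} (h : IsFiniteProjective M) (n : ℤ) :
    IsFiniteProjective (((single (ModuleCat.{u} Λ) (ComplexShape.up ℤ) 0).obj M).X n) := by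
  by_cases hn : n = 0
  · subst hn
    exact h.of_iso (singleObjXSelf (ComplexShape.up ℤ) 0 M).symm
  · exact .of_isZero (isZero_single_obj_X _ _ _ _ hn)

/-! ### Generating bounded complexes from modules in degree `0`. -/

section Generation

variable (S : ObjectProperty (ModHomotopyCategory Λ)) [S.IsTriangulated]
  [S.IsClosedUnderIsomorphisms]

lemma prop_toHomotopy_X₂ {T : ShortComplex (CochainComplex (ModuleCat.{u} Λ) ℤ)}
    (hT : T.ShortExact) (hproj : ∀ n, Module.Projective Λ (T.X₃.X n))
    (h₁ : S (toHomotopy T.X₁)) (h₃ : S (toHomotopy T.X₃)) : S (toHomotopy T.X₂) := by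
  obtain ⟨D, hD, e₁, e₂, e₃⟩ := exists_distinguished_of_shortExact hT hproj
  rw [← e₂]
  exact S.ext_of_isTriangulatedClosed₂ D hD (e₁ ▸ h₁) (e₃ ▸ h₃)

lemma prop_toHomotopy_X₁ {T : ShortComplex (CochainComplex (ModuleCat.{u} Λ) ℤ)}
    (hT : T.ShortExact) (hproj : ∀ n, Module.Projective Λ (T.X₃.X n))
    (h₂ : S (toHomotopy T.X₂)) (h₃ : S (toHomotopy T.X₃)) : S (toHomotopy T.X₁) := by
  obtain ⟨D, hD, e₁, e₂, e₃⟩ := exists_distinguished_of_shortExact hT hproj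
  rw [← e₁]
  exact S.ext_of_isTriangulatedClosed₁ D hD (e₂ ▸ h₂) (e₃ ▸ h₃)

lemma prop_toHomotopy_of_isZero {C : CochainComplex (ModuleCat.{u} Λ) ℤ}
    (hC : ∀ n, IsZero (C.X n)) : S (toHomotopy C) := by
  have h : IsZero C := by
    rw [IsZero.iff_id_eq_zero]
    ext n : 1
    exact (hC n).eq_of_src _ _
  exact S.prop_of_isZero ((HomotopyCategory.quotient _ _).map_isZero h)

lemma prop_toHomotopy_of_iso (S : ObjectProperty (ModHomotopyCategory Λ))
    [S.IsClosedUnderIsomorphisms] {C D : CochainComplex (ModuleCat.{u} Λ) ℤ} (e : C ≅ D)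
    (h : S (toHomotopy C)) : S (toHomotopy D) :=
  S.prop_of_iso ((HomotopyCategory.quotient _ _).mapIso e) h

/-- A complex with one nonzero term `M` in degree `n` belongs to `S` if and only if this holds for
the complex `M` in degree `0`. -/
lemma prop_toHomotopy_iff_single {C : CochainComplex (ModuleCat.{u} Λ) ℤ} {n : ℤ}
    (hC : ∀ m, m ≠ n → IsZero (C.X m)) :
    S (toHomotopy C) ↔
      S (toHomotopy ((single (ModuleCat.{u} Λ) (ComplexShape.up ℤ) 0).obj (C.X n))) := by
  have : C.IsStrictlyGE n := (isStrictlyGE_iff _ _).2 fun m hm => hC m hm.ne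
  have : C.IsStrictlyLE n := (isStrictlyLE_iff _ _).2 fun m hm => hC m hm.ne'
  obtain ⟨M, ⟨e⟩⟩ := C.exists_iso_single n
  have eM : C.X n ≅ M := (HomologicalComplex.eval _ _ n).mapIso e ≪≫ singleObjXSelf (ComplexShape.up ℤ) n M
  let e₁ : toHomotopy C ≅ (HomotopyCategory.singleFunctor (ModuleCat.{u} Λ) n).obj (C.X n) :=
    (HomotopyCategory.quotient _ _).mapIso (e ≪≫ (single _ _ n).mapIso eM.symm)
  let e₂ := ((HomotopyCategory.singleFunctors (ModuleCat.{u} Λ)).shiftIso n 0 n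
    (add_zero n)).app (C.X n)
  rw [S.prop_iff_of_iso e₁, ← S.prop_shift_iff_of_isStableUnderShift _ n]
  exact S.prop_iff_of_iso e₂

lemma prop_single_of_iso (S : ObjectProperty (ModHomotopyCategory Λ))
    [S.IsClosedUnderIsomorphisms] {M N : ModuleCat.{u} Λ} (e : M ≅ N)
    (h : S (toHomotopy ((single (ModuleCat.{u} Λ) (ComplexShape.up ℤ) 0).obj M))) :
    S (toHomotopy ((single (ModuleCat.{u} Λ) (ComplexShape.up ℤ) 0).obj N)) :=
  prop_toHomotopy_of_iso S ((single _ _ 0).mapIso e) h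

lemma prop_single_prod {M N : ModuleCat.{u} Λ} (hN : Module.Projective Λ N)
    (h₁ : S (toHomotopy ((single (ModuleCat.{u} Λ) (ComplexShape.up ℤ) 0).obj M)))
    (h₂ : S (toHomotopy ((single (ModuleCat.{u} Λ) (ComplexShape.up ℤ) 0).obj N))) :
    S (toHomotopy ((single (ModuleCat.{u} Λ) (ComplexShape.up ℤ) 0).obj
      (ModuleCat.of Λ (M × N)))) := by
  let T := ModuleCat.shortComplexOfCompEqZero (LinearMap.inl Λ M N) (LinearMap.snd Λ M N)
    (LinearMap.snd_comp_inl Λ M N)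
  have hT : T.ShortExact := ModuleCat.shortComplex_shortExact T Function.Exact.inl_snd
    LinearMap.inl_injective LinearMap.snd_surjective
  refine prop_toHomotopy_X₂ S (hT.map_of_exact (single (ModuleCat.{u} Λ) (ComplexShape.up ℤ) 0))
    (fun n => ?_) h₁ h₂
  by_cases hn : n = 0
  · subst hn
    exact Module.Projective.of_equiv (singleObjXSelf (ComplexShape.up ℤ) 0 N).symm.toLinearEquiv
  · exact (IsFiniteProjective.of_isZero (isZero_single_obj_X (ComplexShape.up ℤ) 0 N n hn)).2

/-- A triangulated subcategory that contains all finitely generated projective modules contains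
all bounded complexes of finitely generated projective modules. -/
lemma prop_of_isBoundedProjectiveComplex
    (hS : ∀ M : ModuleCat.{u} Λ, IsFiniteProjective M →
      S (toHomotopy ((single (ModuleCat.{u} Λ) (ComplexShape.up ℤ) 0).obj M)))
    {C : CochainComplex (ModuleCat.{u} Λ) ℤ} (hC : IsBoundedProjectiveComplex C) :
    S (toHomotopy C) := by
  -- Induction on the number `l` of degrees `a, …, a + l - 1` that may carry nonzero terms;
  -- truncation splits off the highest term as a subcomplex.
  have key : ∀ (a : ℤ) (l : ℕ) (C : CochainComplex (ModuleCat.{u} Λ) ℤ),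
      (∀ n, IsFiniteProjective (C.X n)) → (∀ n, n < a ∨ a + l ≤ n → IsZero (C.X n)) →
      S (toHomotopy C) := by
    intro a l
    induction l with
    | zero => exact fun C _ h => prop_toHomotopy_of_isZero S fun n => h n (by omega)
    | succ l ih =>
      intro C hp hz
      refine prop_toHomotopy_X₂ S (stupidShortComplex_shortExact C (a + l))
        (fun n => (isFiniteProjective_stupidQuot_X (hp n)).2) ?_ ?_
      · refine (prop_toHomotopy_iff_single S (n := a + l) fun m hm => ?_).2
          (hS _ (isFiniteProjective_stupidSub_X (hp _)))
        rcases lt_or_gt_of_ne hm with h | h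
        · exact isZero_stupidSub_X_of_lt h
        · exact (hz m (by push_cast; omega)).of_iso (nonempty_stupidSub_X_iso h.le).some
      · refine ih _ (fun n => isFiniteProjective_stupidQuot_X (hp n)) fun n hn => ?_
        rcases le_or_gt (a + l) n with h | h
        · exact isZero_stupidQuot_X_of_le h
        · exact (hz n (by omega)).of_iso (nonempty_stupidQuot_X_iso h).some
  obtain ⟨⟨a, b, hab⟩, hp⟩ := hC
  -- If `b + 1 < a`, then `toNat` gives `0`, which is right because every degree is then out of
  -- bounds.
  exact key a (b + 1 - a).toNat C hp fun n hn => hab n (by omega)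

end Generation

/-- A direct sum of bounded complexes of projective modules, with common bounds. -/
lemma isBoundedProjectiveComplex_biproduct {J : Type*} [Finite J]
    (X : J → CochainComplex (ModuleCat.{u} Λ) ℤ) (a b : ℤ)
    (hX : ∀ j n, n < a ∨ b < n → IsZero ((X j).X n))
    (hp : ∀ j n, IsFiniteProjective ((X j).X n)) : IsBoundedProjectiveComplex (⨁ X) := by
  have := Fintype.ofFinite J
  have hid : ∀ n, ∑ j, (biproduct.π X j).f n ≫ (biproduct.ι X j).f n = 𝟙 ((⨁ X).X n) := by
    intro n
    exact ((HomologicalComplex.eval (ModuleCat.{u} Λ) (ComplexShape.up ℤ) n).map_sum _ _).symm.trans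
      (congrArg (fun f => f.f n) (sum_biproduct_π_comp_ι X))
  refine ⟨⟨a, b, fun n hn => ?_⟩, fun n => ?_⟩
  · rw [IsZero.iff_id_eq_zero, ← hid n]
    exact Finset.sum_eq_zero fun j _ => by
      rw [(hX j n hn).eq_of_tgt ((biproduct.π X j).f n) 0, zero_comp]
  · have h1 := fun j => (hp j n).1
    have h2 := fun j => (hp j n).2
    classical
    have h3 : Module.Projective Λ (∀ j, (X j).X n) :=
      Module.Projective.of_equiv (DFinsupp.linearEquivFunOnFintype (R := Λ))
    -- Each term of the biproduct is a retract of the finite product of the terms, which is finitely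
    -- generated and projective.
    let s : (⨁ X).X n →ₗ[Λ] ∀ j, (X j).X n := LinearMap.pi fun j => ((biproduct.π X j).f n).hom
    let r : (∀ j, (X j).X n) →ₗ[Λ] (⨁ X).X n :=
      ∑ j, ((biproduct.ι X j).f n).hom ∘ₗ LinearMap.proj j
    have hrs : r ∘ₗ s = LinearMap.id := by
      have h := congrArg ModuleCat.Hom.hom (hid n)
      ext x
      have hx := LinearMap.congr_fun h x
      simpa [r, s, ModuleCat.hom_sum] using hx
    exact ⟨Module.Finite.of_surjective r (LinearMap.surjective_of_comp_eq_id s r hrs),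
      Module.Projective.of_split s r hrs⟩

/-! ### Morphisms of nonzero degree in the homotopy category. -/

section Hom

variable {X Y : CochainComplex (ModuleCat.{u} Λ) ℤ}

open HomComplex

/-- Vanishing of the morphisms of nonzero degree between two-term complexes. -/
lemma toHomotopy_hom_shift_eq_zero (hX : ∀ n, n ≠ 0 → n ≠ 1 → IsZero (X.X n))
    (hY : ∀ n, n ≠ 0 → n ≠ 1 → IsZero (Y.X n))
    (h₁ : ∀ g : X.X 0 ⟶ Y.X 1, ∃ h : X.X 0 ⟶ Y.X 0, h ≫ Y.d 0 1 = g)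
    (h₂ : ∀ g : X.X 1 ⟶ Y.X 0, X.d 0 1 ≫ g = 0 → g = 0) {r : ℤ} (hr : r ≠ 0)
    (f : toHomotopy X ⟶ (CategoryTheory.shiftFunctor (ModHomotopyCategory Λ) r).obj (toHomotopy Y)) : f = 0 := by
  let e := ((HomotopyCategory.quotient (ModuleCat.{u} Λ) (ComplexShape.up ℤ)).commShiftIso r).app Y
  suffices f ≫ e.inv = 0 by
    rw [← cancel_mono e.inv, this, zero_comp]
  -- Morphisms into the shift are cohomology classes of the Hom complex, so it suffices to show that
  -- each cocycle is a coboundary.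
  obtain ⟨x, hx⟩ := (CohomologyClass.toHom_bijective X Y r).2 (f ≫ e.inv)
  obtain ⟨z, rfl⟩ := x.mk_surjective
  rw [← hx, CohomologyClass.toHom_mk_eq_zero_iff]
  by_cases h1 : r = 1
  · subst h1
    obtain ⟨h, hh⟩ := h₁ (z.1.v 0 1 (by simp))
    rw [mem_coboundaries_iff _ 0 (by simp)]
    -- A cochain of degree `1` has only the component `X⁰ ⟶ Y¹`; its lift through the differential
    -- of `Y` is the homotopy.
    refine ⟨Cochain.single h 0, ?_⟩
    ext p q hpq : 1
    by_cases hp : p = 0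
    · subst hp
      obtain rfl : q = 1 := by omega
      rw [δ_v 0 1 (by simp) _ 0 1 (by simp) 0 1 (by simp) (by simp), Cochain.single_v,
        Cochain.single_v_eq_zero _ _ _ _ _ (by simp), hh, comp_zero, smul_zero, add_zero]
    · by_cases hp1 : p = 1
      · exact (hY q (by omega) (by omega)).eq_of_tgt _ _
      · exact (hX p hp hp1).eq_of_src _ _
  -- Only for `r = -1` can a component `X¹ ⟶ Y⁰` survive, and there the cocycle condition makes it
  -- vanish after composition with the differential of `X`.
  · suffices z = 0 by rw [this]; exact zero_mem _
    ext p q hpq : 2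
    by_cases hp : p = 0
    · exact (hY q (by omega) (by omega)).eq_of_tgt _ _
    by_cases hp1 : p = 1
    · subst hp1
      by_cases hq : q = 0
      · subst hq
        obtain rfl : r = -1 := by omega
        refine h₂ _ ?_
        have h := Cochain.congr_v (Cocycle.δ_eq_zero z 0) 0 0 (by simp)
        rw [δ_v (-1) 0 (by simp) _ 0 0 (by simp) (-1) 1 (by simp) (by simp),
          (hY (-1) (by simp) (by simp)).eq_of_tgt (z.1.v 0 (-1) _) 0, zero_comp, zero_add] at h
        simpa using h
      · exact (hY q hq (by omega)).eq_of_tgt _ _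
    · exact (hX p hp hp1).eq_of_src _ _

/-- A morphism between finite sums is the sum of its matrix entries. -/
lemma toHomotopy_biproduct_hom_shift_eq_zero {J : Type*} [Finite J]
    (X : J → CochainComplex (ModuleCat.{u} Λ) ℤ) {r : ℤ}
    (h : ∀ j k, ∀ f : toHomotopy (X j) ⟶
      (CategoryTheory.shiftFunctor (ModHomotopyCategory Λ) r).obj (toHomotopy (X k)), f = 0)
    (f : toHomotopy (⨁ X) ⟶ (CategoryTheory.shiftFunctor (ModHomotopyCategory Λ) r).obj (toHomotopy (⨁ X))) :
    f = 0 := by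
  have := Fintype.ofFinite J
  let Q := HomotopyCategory.quotient (ModuleCat.{u} Λ) (ComplexShape.up ℤ)
  have hid : 𝟙 (toHomotopy (⨁ X)) = ∑ j, Q.map (biproduct.π X j) ≫ Q.map (biproduct.ι X j) := by
    simp only [← Functor.map_comp]
    rw [← Functor.map_sum, sum_biproduct_π_comp_ι, Q.map_id]
  rw [← Category.id_comp f, ← Category.comp_id f,
    ← (CategoryTheory.shiftFunctor (ModHomotopyCategory Λ) r).map_id, hid, Functor.map_sum,
    Preadditive.sum_comp]
  refine Finset.sum_eq_zero fun j _ => ?_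
  rw [Preadditive.comp_sum, Preadditive.comp_sum]
  refine Finset.sum_eq_zero fun k _ => ?_
  have h0 := h j k (Q.map (biproduct.ι X j) ≫ f ≫
    (CategoryTheory.shiftFunctor (ModHomotopyCategory Λ) r).map (Q.map (biproduct.π X k)))
  rw [Functor.map_comp, Category.assoc, reassoc_of% h0]
  simp

end Hom

end

/-! ### Two-term complexes and the tilting property. -/

namespace SpecialBiserialPresentation

universe u

variable {K V : Type*} {Λ : Type u} [Field K] [Ring Λ] [Algebra K Λ]
  [Quiver V] [Fintype V] [∀ i j : V, Finite (i ⟶ j)] {P : SpecialBiserialPresentation K Λ V}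

open HomologicalComplex

lemma IsAddAway.isFiniteProjective {i : V} {M : ModuleCat.{u} Λ} (h : P.IsAddAway i M) :
    IsFiniteProjective M := by
  induction h with
  | proj j _ => exact ⟨inferInstanceAs (Module.Finite Λ (P.proj j)),
      inferInstanceAs (Module.Projective Λ (P.proj j))⟩
  | @prod M N _ _ h₁ h₂ =>
    have := h₁.1
    have := h₁.2
    have := h₂.1
    have := h₂.2
    exact ⟨inferInstanceAs (Module.Finite Λ (M × N)),
      inferInstanceAs (Module.Projective Λ (M × N))⟩

lemma isFiniteProjective_proj (j : V) : IsFiniteProjective (ModuleCat.of Λ (P.proj j)) :=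
  ⟨inferInstanceAs (Module.Finite Λ (P.proj j)), inferInstanceAs (Module.Projective Λ (P.proj j))⟩

section TwoTerm

variable {M N : Type u} [AddCommGroup M] [Module Λ M] [AddCommGroup N] [Module Λ N]
  (f : M →ₗ[Λ] N)

/-- The term of degree `0` of a two-term complex. -/
noncomputable def twoTermXIso₀ : (twoTerm f).X 0 ≅ ModuleCat.of Λ M := doubleXIso₀ _ _

/-- The term of degree `1` of a two-term complex. -/
noncomputable def twoTermXIso₁ : (twoTerm f).X 1 ≅ ModuleCat.of Λ N :=
  doubleXIso₁ _ _ zero_ne_one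

lemma twoTerm_d : (twoTerm f).d 0 1 =
    (twoTermXIso₀ f).hom ≫ ModuleCat.ofHom f ≫ (twoTermXIso₁ f).inv :=
  double_d _ _ zero_ne_one

lemma isZero_twoTerm_X {n : ℤ} (h₀ : n ≠ 0) (h₁ : n ≠ 1) : IsZero ((twoTerm f).X n) :=
  isZero_double_X _ _ _ h₀ h₁

lemma isFiniteProjective_twoTerm_X (hM : IsFiniteProjective (ModuleCat.of Λ M))
    (hN : IsFiniteProjective (ModuleCat.of Λ N)) (n : ℤ) :
    IsFiniteProjective ((twoTerm f).X n) := by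
  by_cases h₀ : n = 0
  · subst h₀
    exact hM.of_iso (twoTermXIso₀ f).symm
  by_cases h₁ : n = 1
  · subst h₁
    exact hN.of_iso (twoTermXIso₁ f).symm
  · exact .of_isZero (isZero_twoTerm_X f h₀ h₁)

end TwoTerm

section Tilting

variable {i : V} {N : ModuleCat.{u} Λ} {f : N →ₗ[Λ] P.proj i}
  {X : V → CochainComplex (ModuleCat.{u} Λ) ℤ}

lemma IsApproximation.exists_comp_d_eq (hf : P.IsApproximation f) {A M : ModuleCat.{u} Λ}
    (e : A ≅ M) (hM : P.IsAddAway i M) (g : A ⟶ (twoTerm f).X 1) :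
    ∃ h : A ⟶ (twoTerm f).X 0, h ≫ (twoTerm f).d 0 1 = g := by
  obtain ⟨h, hh⟩ := hf.exists_comp_eq hM (e.inv ≫ g ≫ (twoTermXIso₁ f).hom).hom
  refine ⟨e.hom ≫ ModuleCat.ofHom h ≫ (twoTermXIso₀ f).inv, ?_⟩
  have h' : ModuleCat.ofHom h ≫ ModuleCat.ofHom f = e.inv ≫ g ≫ (twoTermXIso₁ f).hom :=
    ModuleCat.hom_ext hh
  rw [twoTerm_d, Category.assoc, Category.assoc, Iso.inv_hom_id_assoc, reassoc_of% h',
    Iso.hom_inv_id, Category.comp_id, Iso.hom_inv_id_assoc]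

lemma IsApproximation.eq_zero_of_d_comp (hf : P.IsApproximation f) {B M : ModuleCat.{u} Λ}
    (e : B ≅ M) (hM : P.IsAddAway i M) (g : (twoTerm f).X 1 ⟶ B)
    (hg : (twoTerm f).d 0 1 ≫ g = 0) : g = 0 := by
  have h := hf.eq_zero_of_comp hM ((twoTermXIso₁ f).inv ≫ g ≫ e.hom).hom (by
    have h1 : ModuleCat.ofHom f ≫ (twoTermXIso₁ f).inv ≫ g ≫ e.hom = 0 := by
      rw [twoTerm_d, Category.assoc, Category.assoc, ← cancel_epi (twoTermXIso₀ f).inv,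
        Iso.inv_hom_id_assoc, comp_zero] at hg
      rw [reassoc_of% hg, zero_comp]
    exact congrArg ModuleCat.Hom.hom h1)
  have h' : (twoTermXIso₁ f).inv ≫ g ≫ e.hom = 0 := ModuleCat.hom_ext h
  rw [← cancel_epi (twoTermXIso₁ f).inv, ← cancel_mono e.hom, Category.assoc, h', comp_zero,
    zero_comp]

/-- A triangulated subcategory that contains the `P_j`, `j ≠ i`, and the approximation of `P_i`
contains all bounded complexes of finitely generated projective modules. -/
lemma prop_of_twoTerm (S : ObjectProperty (ModHomotopyCategory Λ)) [S.IsTriangulated]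
    [S.IsClosedUnderIsomorphisms] (hN : P.IsAddAway i N) (hi : S (toHomotopy (twoTerm f)))
    (hj : ∀ j, j ≠ i → S (toHomotopy
      ((single (ModuleCat.{u} Λ) (ComplexShape.up ℤ) 0).obj (ModuleCat.of Λ (P.proj j)))))
    {Y : ModHomotopyCategory Λ} (hY : KbProj Λ Y) : S Y := by
  have hadd : ∀ {M : ModuleCat.{u} Λ}, P.IsAddAway i M →
      S (toHomotopy ((single (ModuleCat.{u} Λ) (ComplexShape.up ℤ) 0).obj M)) := by
    intro M hM
    induction hM with
    | proj j h => exact hj j h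
    | prod _ h₂ ih₁ ih₂ => exact prop_single_prod S h₂.isFiniteProjective.2 ih₁ ih₂
  -- Truncation at degree `1` presents the two-term complex as an extension of `N` in degree `0` by
  -- `P_i` in degree `1`; two of the three are in `S`, hence so is the third.
  have hquot : S (toHomotopy (CochainComplex.stupidQuot (twoTerm f) 1)) := by
    refine (prop_toHomotopy_iff_single S (n := 0) fun m hm => ?_).2 (prop_single_of_iso S
      ((CochainComplex.nonempty_stupidQuot_X_iso zero_lt_one).some ≪≫ twoTermXIso₀ f).symm
      (hadd hN))
    rcases le_or_gt 1 m with h | h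
    · exact CochainComplex.isZero_stupidQuot_X_of_le h
    · exact (isZero_twoTerm_X f hm h.ne).of_iso (CochainComplex.nonempty_stupidQuot_X_iso h).some
  have hsub : S (toHomotopy (CochainComplex.stupidSub (twoTerm f) 1)) :=
    prop_toHomotopy_X₁ S (CochainComplex.stupidShortComplex_shortExact (twoTerm f) 1)
      (fun n => (isFiniteProjective_stupidQuot_X (isFiniteProjective_twoTerm_X f
        hN.isFiniteProjective (isFiniteProjective_proj i) n)).2) hi hquot
  have hPi : S (toHomotopy ((single (ModuleCat.{u} Λ) (ComplexShape.up ℤ) 0).obj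
      (ModuleCat.of Λ (P.proj i)))) := by
    refine prop_single_of_iso S
      ((CochainComplex.nonempty_stupidSub_X_iso le_rfl).some ≪≫ twoTermXIso₁ f)
      ((prop_toHomotopy_iff_single S (n := 1) fun m hm => ?_).1 hsub)
    rcases lt_or_ge m 1 with h | h
    · exact CochainComplex.isZero_stupidSub_X_of_lt h
    · exact (isZero_twoTerm_X f (by omega) hm).of_iso
        (CochainComplex.nonempty_stupidSub_X_iso h).some
  obtain ⟨C, hC, ⟨e⟩⟩ := hY
  refine S.prop_of_iso e.symm (prop_of_isBoundedProjectiveComplex S (fun M hM => ?_) hC)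
  have := hM.1
  have := hM.2
  refine P.projective_induction (motive := fun M => S (toHomotopy
    ((single (ModuleCat.{u} Λ) (ComplexShape.up ℤ) 0).obj M)))
    (fun e => prop_single_of_iso S e.toModuleIso) (fun M hM => ?_) (fun j => ?_)
    (fun M N hN => prop_single_prod S hN) M
  · refine prop_toHomotopy_of_isZero S fun n => ?_
    exact (single (ModuleCat.{u} Λ) (ComplexShape.up ℤ) 0 ⋙
      HomologicalComplex.eval _ _ n).map_isZero (ModuleCat.isZero_of_subsingleton M)
  · by_cases h : j = i
    · subst h; exact hPi
    · exact hj j h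

/-- An arbitrary family `X` with prescribed summands covers the three kinds of data at once and
avoids the `if` in `ElementaryData.complex`. -/
lemma isTiltingComplex_biproduct (hN : P.IsAddAway i N) (hf : P.IsApproximation f)
    (hi : X i = twoTerm f) (hj : ∀ j, j ≠ i → X j =
      (single (ModuleCat.{u} Λ) (ComplexShape.up ℤ) 0).obj (ModuleCat.of Λ (P.proj j))) :
    IsTiltingComplex (⨁ X) := by
  have hzero : ∀ j n, n ≠ 0 → n ≠ 1 → IsZero ((X j).X n) := by
    intro j n h₀ h₁
    by_cases h : j = i
    · subst h
      rw [hi]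
      exact isZero_twoTerm_X f h₀ h₁
    · rw [hj j h]
      exact isZero_single_obj_X _ _ _ _ h₀
  have hproj : ∀ j n, IsFiniteProjective ((X j).X n) := by
    intro j n
    by_cases h : j = i
    · subst h
      rw [hi]
      exact isFiniteProjective_twoTerm_X f hN.isFiniteProjective (isFiniteProjective_proj j) n
    · rw [hj j h]
      exact isFiniteProjective_single_X (isFiniteProjective_proj j) n
  -- The degree `0` term of `T_ii` itself is also a sum of modules `P_j`, `j ≠ i`, so the
  -- approximation properties handle maps from `T_ii` to itself too.
  have hadd : ∀ j, ∃ M, P.IsAddAway i M ∧ Nonempty ((X j).X 0 ≅ M) := by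
    intro j
    by_cases h : j = i
    · subst h
      rw [hi]
      exact ⟨N, hN, ⟨twoTermXIso₀ f⟩⟩
    · rw [hj j h]
      exact ⟨_, .proj j h, ⟨singleObjXSelf (ComplexShape.up ℤ) 0 _⟩⟩
  have hX₁ : ∀ j, j ≠ i → IsZero ((X j).X 1) := by
    intro j h
    rw [hj j h]
    exact isZero_single_obj_X _ _ _ _ one_ne_zero
  refine ⟨isBoundedProjectiveComplex_biproduct X 0 1
    (fun j n hn => hzero j n (by omega) (by omega)) hproj, ?_, ?_⟩
  · intro S _ _ hS Y hY
    have hSX : ∀ j, S (toHomotopy (X j)) := fun j =>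
      hS _ ⟨X j, ⟨⟨0, 1, fun n hn => hzero j n (by omega) (by omega)⟩, hproj j⟩, ⟨Iso.refl _⟩⟩
        ⟨(Retract.mk (biproduct.ι X j) (biproduct.π X j)).map
          (HomotopyCategory.quotient (ModuleCat.{u} Λ) (ComplexShape.up ℤ))⟩
    exact prop_of_twoTerm S hN (hi ▸ hSX i) (fun j h => hj j h ▸ hSX j) hY
  · intro r hr
    refine toHomotopy_biproduct_hom_shift_eq_zero X fun j k =>
      toHomotopy_hom_shift_eq_zero (hzero j) (hzero k) ?_ ?_ hr
    · intro g
      by_cases h : k = i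
      · subst h
        obtain ⟨M, hM, ⟨e⟩⟩ := hadd j
        revert g
        rw [hi]
        exact hf.exists_comp_d_eq e hM
      · exact ⟨0, (hX₁ k h).eq_of_tgt _ _⟩
    · intro g
      by_cases h : j = i
      · subst h
        obtain ⟨M, hM, ⟨e⟩⟩ := hadd k
        revert g
        rw [hi]
        exact hf.eq_zero_of_d_comp e hM
      · exact fun _ => (hX₁ j h).eq_of_src _ _

end Tilting

end SpecialBiserialPresentation

theorem mainTheorem5 {K : Type*} [Field K] {V : Type*} [Quiver V] [Fintype V]
    [∀ i j : V, Finite (i ⟶ j)] {Λ : Type*} [Ring Λ] [Algebra K Λ]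
    (hΛ : HasSymmetrizingForm K Λ) (P : SpecialBiserialPresentation K Λ V) (i : V)
    (hi : ∃ j : V, j ≠ i ∧
      Quiver.WeaklyConnectedComponent.mk j = Quiver.WeaklyConnectedComponent.mk i) :
    Nonempty (P.ElementaryData i) ∧
      ∀ D : P.ElementaryData i, IsTiltingComplex D.complex := by
  obtain ⟨j, hj, hij⟩ := hi
  refine ⟨P.nonempty_elementaryData hΛ hj hij, fun D => ?_⟩
  obtain ⟨N, f, hD, hN, hf⟩ := D.exists_isApproximation hΛ
  exact SpecialBiserialPresentation.isTiltingComplex_biproduct hN hf ((if_pos rfl).trans hD) fun j hj => if_neg hj
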